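/- Let $F$ be a Borel probability measure on $\mathbb{R}^2$, the law of a pair $(X,Y)$, with marginals $\mu$ (the law of $X$) and $\nu$ (the law of $Y$). Assume that $F\ll\mu\otimes\nu$ with $$\int\!\!\int\Big(\frac{dF}{d(\mu\otimes\nu)}(x,y)\Big)^2\,d\mu(x)\,d\nu(y)<\infty ,$$ and that $\mu$ and $\nu$ are identifiable by their moments: each of them has finite moments of all orders and is the only finite measure on $\mathbb{R}$ with these moments. Let $(\alpha_n)_{n\ge 0}$ and $(\beta_n)_{n\ge 0}$ be the real orthogonal polynomials of $\mu$ and $\nu$: $\alpha_n$ and $\beta_n$ have degree exactly $n$, $\int\alpha_m\alpha_n\,d\mu=0$ and $\int\beta_m\beta_n\,d\nu=0$ for $m\ne n$. (They are unique up to nonzero factors, except that for a marginal supported by exactly $N<\infty$ points the polynomials of index $n\ge N$ are only required to vanish on the support, so that they do not matter.) By a Lancaster expansion of $F$ with coefficients $c_n\in\mathbb{R}$ we mean $$dF(x,y)=d\mu(x)\,d\nu(y)\sum_{n\ge 0}c_n\,\alpha_n(x)\beta_n(y),$$ where the series converges to $dF/d(\mu\otimes\nu)$ in $L^2(\mu\otimes\nu)$.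 (i) $F$ has a Lancaster expansion if and only if for every $n\ge 0$ there are real polynomials $p_n,q_n$ of degree at most $n$ such that $E(X^n\mid Y)=p_n(Y)$ and $E(Y^n\mid X)=q_n(X)$ almost surely. (ii) Suppose that the supports of $\mu$ and $\nu$ are both infinite or have the same finite number of points. Then $F$ has a Lancaster expansion with $c_n\neq 0$ for all $n$ if and only if for every $n\ge 0$ there are real polynomials $p_n,q_n$ of full order $n$ (that is, of degree exactly $n$) such that $E(X^n\mid Y)=p_n(Y)$ and $E(Y^n\mid X)=q_n(X)$ almost surely. -/

import Mathlib

open MeasureTheory ProbabilityTheory Filter Topology Polynomial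

/-- A measure on the line is identifiable by its moments: all its moments are finite, and it is
the only finite measure with these moments. -/
def IsMomentDeterminate (μ : Measure ℝ) : Prop :=
  (∀ n : ℕ, Integrable (fun x : ℝ => x ^ n) μ) ∧
    ∀ (ρ : Measure ℝ) [IsFiniteMeasure ρ],
      (∀ n : ℕ, Integrable (fun x : ℝ => x ^ n) ρ) →
      (∀ n : ℕ, ∫ x, x ^ n ∂ρ = ∫ x, x ^ n ∂μ) → ρ = μ

/-- The density of a bivariate distribution with respect to the product of its marginals
(`F.fst` and `F.snd` are the laws of the first and of the second coordinate). -/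
noncomputable def productDensity (F : Measure (ℝ × ℝ)) (z : ℝ × ℝ) : ℝ :=
  (F.rnDeriv (F.fst.prod F.snd) z).toReal

/-- `F` is absolutely continuous with respect to the product of its marginals, with a
square-integrable density. -/
def HasSquareIntegrableDensity (F : Measure (ℝ × ℝ)) : Prop :=
  F ≪ F.fst.prod F.snd ∧ MemLp (productDensity F) 2 (F.fst.prod F.snd)

/-- Orthogonal polynomials of a measure: `α n` has degree exactly `n`, and different members are
orthogonal. If `μ` has infinite support, each `α n` is determined up to a nonzero factor; if the
support has `N` points, this holds for `n < N`, while `α n` vanishes on the support for `n ≥ N`,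
so that the usual finite orthogonal families are covered as well. -/
def IsOrthogonalPolySeq (μ : Measure ℝ) (α : ℕ → ℝ[X]) : Prop :=
  (∀ n : ℕ, (α n).degree = n) ∧
    ∀ m n : ℕ, m ≠ n → ∫ x, (α m).eval x * (α n).eval x ∂μ = 0

/-- `dF(x, y) = dμ(x) dν(y) ∑ c n * α n (x) * β n (y)`, the series being convergent in mean square
with respect to the product of the marginals `μ` and `ν` of `F`. -/
def HasLancasterExpansion (F : Measure (ℝ × ℝ)) (α β : ℕ → ℝ[X]) (c : ℕ → ℝ) : Prop :=
  F ≪ F.fst.prod F.snd ∧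
    Tendsto (fun N : ℕ =>
        eLpNorm (fun z : ℝ × ℝ => productDensity F z -
          ∑ n ∈ Finset.range N, c n * (α n).eval z.1 * (β n).eval z.2) 2 (F.fst.prod F.snd))
      atTop (𝓝 0)

/-- The Lancaster class. -/
def IsLancasterClass (F : Measure (ℝ × ℝ)) : Prop :=
  IsMomentDeterminate F.fst ∧ IsMomentDeterminate F.snd ∧ HasSquareIntegrableDensity F ∧
    ∃ (α β : ℕ → ℝ[X]) (c : ℕ → ℝ), IsOrthogonalPolySeq F.fst α ∧ IsOrthogonalPolySeq F.snd β ∧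
      HasLancasterExpansion F α β c

/-- The Lancaster class with no vanishing coefficient in the expansion. -/
def IsNondegenerateLancasterClass (F : Measure (ℝ × ℝ)) : Prop :=
  IsMomentDeterminate F.fst ∧ IsMomentDeterminate F.snd ∧ HasSquareIntegrableDensity F ∧
    ∃ (α β : ℕ → ℝ[X]) (c : ℕ → ℝ), IsOrthogonalPolySeq F.fst α ∧ IsOrthogonalPolySeq F.snd β ∧
      (∀ n : ℕ, c n ≠ 0) ∧ HasLancasterExpansion F α β c

/-- `E(X ^ n | Y) = p(Y)` almost surely, where `(X, Y)` has law `F`. -/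
def CondMomentFstEq (F : Measure (ℝ × ℝ)) (n : ℕ) (p : ℝ[X]) : Prop :=
  F[fun z : ℝ × ℝ => z.1 ^ n | MeasurableSpace.comap (Prod.snd : ℝ × ℝ → ℝ) inferInstance]
    =ᵐ[F] fun z => p.eval z.2

/-- `E(Y ^ n | X) = q(X)` almost surely, where `(X, Y)` has law `F`. -/
def CondMomentSndEq (F : Measure (ℝ × ℝ)) (n : ℕ) (q : ℝ[X]) : Prop :=
  F[fun z : ℝ × ℝ => z.2 ^ n | MeasurableSpace.comap (Prod.fst : ℝ × ℝ → ℝ) inferInstance]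
    =ᵐ[F] fun z => q.eval z.1

/-- The polynomial class: the conditional moments of order `n` are polynomials of the full
order `n`, that is, with nonzero coefficient at the `n`-th power. -/
def IsPolynomialClass (F : Measure (ℝ × ℝ)) : Prop :=
  IsMomentDeterminate F.fst ∧ IsMomentDeterminate F.snd ∧
    ∀ n : ℕ, (∃ p : ℝ[X], p.degree = n ∧ CondMomentFstEq F n p) ∧
      ∃ q : ℝ[X], q.degree = n ∧ CondMomentSndEq F n q

/-- The variant of the polynomial class in which the conditional moments of order `n` are
polynomials of order at most `n`. -/
def IsWeakPolynomialClass (F : Measure (ℝ × ℝ)) : Prop :=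
  IsMomentDeterminate F.fst ∧ IsMomentDeterminate F.snd ∧
    ∀ n : ℕ, (∃ p : ℝ[X], p.degree ≤ n ∧ CondMomentFstEq F n p) ∧
      ∃ q : ℝ[X], q.degree ≤ n ∧ CondMomentSndEq F n q

/-! Write `s n` for the integral of `α n ^ 2` against `μ`. Pairing a Lancaster series with `α n (x)
ψ(y)` leaves one term, so `E(α n (X) | Y) = c n * s n * β n (Y)`; expanding `X ^ n` along the `α k`
makes its conditional expectation a polynomial of degree at most `n`. Conversely, if conditional
moments are polynomials of these degrees, then `E(α m (X) | Y)` has degree at most `m`, hence is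
orthogonal to `β n` for `n > m`. By symmetry only the diagonal Fourier coefficients of the density
survive, and its Fourier series is a Lancaster series, provided the products `α m (x) β n (y)` are
total in `L²(μ ⊗ ν)`.

Totality is where determinacy enters, through M. Riesz's theorem (`IsPolyOrthogonal.ae_eq_zero`). A
nonzero obstruction to density would allow a multiple of `Re P(i)` to be subtracted from `P ↦ ∫ P /
(1 + x²) dμ` without losing positivity; Hamburger's theorem would then give a second measure with
the moments of `μ`. Totality passes to the product by Fubini.

For full order, the leading coefficient of the conditional moment is `c n * s n` up to nonzero
factors. It can vanish with `c n ≠ 0` only if `μ` has at most `n` points. Then so does `ν`, and a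
polynomial of degree `n` vanishing on the support of `ν` can be added. Conversely, full order forces
`β n = 0` almost everywhere whenever `c n = 0`, so that `c n` may be replaced by `1`. -/

/-! ### Nonnegative polynomials as sums of two squares -/

/-- A real polynomial that is nonnegative on the line is a sum of two squares. -/
theorem Polynomial.exists_sq_add_sq_of_nonneg (P : ℝ[X]) (hP : ∀ x, 0 ≤ P.eval x) :
    ∃ A B : ℝ[X], P = A ^ 2 + B ^ 2 := by
  induction h : P.natDegree using Nat.strong_induction_on generalizing P with
  | _ d ih =>
  subst h
  by_cases hd : P.natDegree = 0
  · rw [natDegree_eq_zero] at hd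
    obtain ⟨c, rfl⟩ := hd
    have hc : 0 ≤ c := by simpa using hP 0
    exact ⟨C (√c), 0, by rw [← C_pow, Real.sq_sqrt hc]; simp⟩
  have hP0 : P ≠ 0 := by rintro rfl; simp at hd
  have hroot : ∃ z : ℂ, aeval z P = 0 := by
    have := Complex.exists_root (f := P.map (algebraMap ℝ ℂ)) (by
      rw [degree_map]; exact natDegree_pos_iff_degree_pos.1 (Nat.pos_of_ne_zero hd))
    obtain ⟨z, hz⟩ := this
    exact ⟨z, by rwa [IsRoot, eval_map_algebraMap] at hz⟩
  obtain ⟨z, hz⟩ := hroot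
  by_cases him : z.im = 0
  · have hr : P.eval z.re = 0 := by
      have hzr : z = (z.re : ℂ) := Complex.ext rfl (by simpa using him)
      rw [hzr] at hz
      have : (algebraMap ℝ ℂ) (P.eval z.re) = 0 := by
        rw [← aeval_algebraMap_apply_eq_algebraMap_eval]; exact hz
      simpa using this
    obtain ⟨Q, hQ⟩ := dvd_iff_isRoot.2 hr
    set a := z.re
    have hQe : ∀ x, P.eval x = (x - a) * Q.eval x := fun x => by rw [hQ]; simp
    -- The cofactor `Q` is nonpositive to the left of `a` and nonnegative to the right, so the root
    -- is at least double.
    have hQa : Q.eval a = 0 := by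
      refine le_antisymm ?_ ?_
      · refine le_of_tendsto (x := 𝓝[<] a)
          (Q.continuous.tendsto a |>.mono_left nhdsWithin_le_nhds) ?_
        filter_upwards [self_mem_nhdsWithin] with x hx
        have := hP x
        rw [hQe] at this
        have hx' : x - a < 0 := sub_neg.2 hx
        by_contra hc
        nlinarith
      · refine ge_of_tendsto (x := 𝓝[>] a)
          (Q.continuous.tendsto a |>.mono_left nhdsWithin_le_nhds) ?_
        filter_upwards [self_mem_nhdsWithin] with x hx
        have := hP x
        rw [hQe] at this
        have hx' : 0 < x - a := sub_pos.2 hx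
        by_contra hc
        nlinarith
    obtain ⟨R, hR⟩ := dvd_iff_isRoot.2 hQa
    have hPR : P = (X - C a) ^ 2 * R := by rw [hQ, hR]; ring
    have hRe : ∀ x, P.eval x = (x - a) ^ 2 * R.eval x := fun x => by rw [hPR]; simp
    have hR0 : R ≠ 0 := by rintro rfl; simp at hPR; exact hP0 hPR
    have hRpos : ∀ x, 0 ≤ R.eval x := by
      have hne : ∀ x, x ≠ a → 0 ≤ R.eval x := fun x hx => by
        have h1 := hP x
        rw [hRe] at h1
        exact nonneg_of_mul_nonneg_right h1 (by have := sub_ne_zero.2 hx; positivity)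
      intro x
      by_cases hx : x = a
      · rw [hx]
        refine ge_of_tendsto (x := 𝓝[≠] a)
          (R.continuous.tendsto a |>.mono_left nhdsWithin_le_nhds) ?_
        filter_upwards [self_mem_nhdsWithin] with y hy using hne y hy
      · exact hne x hx
    have hdeg : P.natDegree = 2 + R.natDegree := by
      rw [hPR, natDegree_mul (pow_ne_zero _ (X_sub_C_ne_zero a)) hR0, natDegree_pow,
        natDegree_X_sub_C]
    obtain ⟨A, B, hAB⟩ := ih R.natDegree (by omega) R hRpos rfl
    exact ⟨(X - C a) * A, (X - C a) * B, by rw [hPR, hAB]; ring⟩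
  · obtain ⟨R, hPR⟩ := P.quadratic_dvd_of_aeval_eq_zero_im_ne_zero hz him
    -- The quadratic factor is itself a sum of two squares, and such sums are closed under products
    -- (Brahmagupta's identity).
    have hq : (X ^ 2 - C (2 * z.re) * X + C (‖z‖ ^ 2) : ℝ[X]) = (X - C z.re) ^ 2 + C z.im ^ 2 := by
      rw [← Complex.normSq_eq_norm_sq, Complex.normSq_apply]
      simp only [C_add, C_mul, map_ofNat]
      ring
    rw [hq] at hPR
    have hR0 : R ≠ 0 := by rintro rfl; simp at hPR; exact hP0 hPR
    have hq2 : ((X - C z.re) ^ 2 + C z.im ^ 2 : ℝ[X]).natDegree = 2 := by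
      rw [← C_pow, natDegree_add_C, natDegree_pow, natDegree_X_sub_C]
    have hdeg : P.natDegree = 2 + R.natDegree := by
      rw [hPR, natDegree_mul (by rintro h; rw [h] at hq2; simp at hq2) hR0, hq2]
    have hRpos : ∀ x, 0 ≤ R.eval x := fun x => by
      have h1 := hP x
      rw [hPR] at h1
      simp only [eval_mul, eval_add, eval_pow, eval_sub, eval_X, eval_C] at h1
      exact nonneg_of_mul_nonneg_right h1 (by positivity)
    obtain ⟨A, B, hAB⟩ := ih R.natDegree (by omega) R hRpos rfl
    exact ⟨(X - C z.re) * A - C z.im * B, (X - C z.re) * B + C z.im * A, by rw [hPR, hAB]; ring⟩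

/-! ### Hamburger's moment theorem -/

/-- Continuous cutoff functions, equal to one on `[-k, k]`. -/
noncomputable def cutoff (k : ℕ) (x : ℝ) : ℝ := max 0 (min 1 (k + 1 - |x|))

lemma cutoff_nonneg (k : ℕ) (x : ℝ) : 0 ≤ cutoff k x := le_max_left _ _

lemma cutoff_le_one (k : ℕ) (x : ℝ) : cutoff k x ≤ 1 := max_le zero_le_one (min_le_left _ _)

lemma cutoff_eq_one {k : ℕ} {x : ℝ} (h : |x| ≤ k) : cutoff k x = 1 := by
  rw [cutoff, min_eq_left (by linarith), max_eq_right zero_le_one]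

lemma cutoff_eq_zero {k : ℕ} {x : ℝ} (h : k + 1 ≤ |x|) : cutoff k x = 0 := by
  rw [cutoff, max_eq_left]
  exact (min_le_right _ _).trans (by linarith)

lemma continuous_cutoff (k : ℕ) : Continuous (cutoff k) := by
  unfold cutoff; fun_prop

lemma tendsto_cutoff (x : ℝ) : Tendsto (fun k => cutoff k x) atTop (𝓝 1) := by
  refine tendsto_const_nhds.congr' ?_
  obtain ⟨N, hN⟩ := exists_nat_ge |x|
  filter_upwards [eventually_ge_atTop N] with k hk
  exact (cutoff_eq_one (hN.trans (by exact_mod_cast hk))).symm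

open CompactlySupported in
/-- The truncation of a polynomial by a cutoff function. -/
noncomputable def truncatePoly (k : ℕ) (P : ℝ[X]) : C_c(ℝ, ℝ) where
  toFun x := cutoff k x * P.eval x
  continuous_toFun := (continuous_cutoff k).mul P.continuous
  hasCompactSupport' := by
    refine HasCompactSupport.intro (isCompact_Icc (a := -(k + 1 : ℝ)) (b := k + 1)) fun x hx => ?_
    have : (k : ℝ) + 1 ≤ |x| := by
      by_contra h
      exact hx (abs_le.1 (not_le.1 h).le)
    rw [cutoff_eq_zero this, zero_mul]

open CompactlySupported in
lemma truncatePoly_apply (k : ℕ) (P : ℝ[X]) (x : ℝ) :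
    truncatePoly k P x = cutoff k x * P.eval x := rfl

open CompactlySupported in
/-- A linear functional that is nonnegative on the nonnegative polynomials extends to a positive
linear functional on polynomials plus compactly supported continuous functions. -/
theorem exists_positive_extension (L : ℝ[X] →ₗ[ℝ] ℝ)
    (hL : ∀ P : ℝ[X], (∀ x, 0 ≤ P.eval x) → 0 ≤ L P) :
    ∃ Φ : C_c(ℝ, ℝ) →ₗ[ℝ] ℝ, ∀ (P : ℝ[X]) (f : C_c(ℝ, ℝ)),
      (∀ x, f x ≤ P.eval x) → Φ f ≤ L P := by
  -- The cone lives on pairs `(P, f)` and tests the sign of `P + f`. M. Riesz's extension theorem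
  -- extends `L` from the pairs `(P, 0)`.
  let s : PointedCone ℝ (ℝ[X] × C_c(ℝ, ℝ)) :=
    { carrier := {p | ∀ x, 0 ≤ p.1.eval x + p.2 x}
      add_mem' := by
        intro p q hp hq x
        have := add_nonneg (hp x) (hq x)
        simp only [Prod.fst_add, Prod.snd_add, eval_add, CompactlySupportedContinuousMap.coe_add,
          Pi.add_apply]
        linarith
      zero_mem' := by intro x; simp
      smul_mem' := by
        rintro ⟨c, hc⟩ p hp x
        have := mul_nonneg hc (hp x)
        simp only [Nonneg.mk_smul, Prod.smul_fst, Prod.smul_snd, eval_smul, smul_eq_mul,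
          CompactlySupportedContinuousMap.coe_smul, Pi.smul_apply]
        linarith }
  have hs : ∀ p, p ∈ s ↔ ∀ x, 0 ≤ p.1.eval x + p.2 x := fun p => Iff.rfl
  let f : (ℝ[X] × C_c(ℝ, ℝ)) →ₗ.[ℝ] ℝ :=
    { domain := LinearMap.range (LinearMap.inl ℝ ℝ[X] C_c(ℝ, ℝ))
      toFun := (L.comp (LinearMap.fst ℝ ℝ[X] C_c(ℝ, ℝ))).comp (Submodule.subtype _) }
  obtain ⟨g, hg, hgs⟩ := riesz_extension s f
    (by
      rintro ⟨_, P, rfl⟩ hx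
      exact hL P fun x => by simpa using (hs _).1 hx x)
    (by
      rintro ⟨P, φ⟩
      -- Adding `(M - P, 0)` to `(P, φ)` leaves `M + φ`, nonnegative since `φ` is bounded.
      obtain ⟨M, hM⟩ := (φ.hasCompactSupport.exists_bound_of_continuous φ.continuous)
      refine ⟨⟨_, C M - P, rfl⟩, fun x => ?_⟩
      have := neg_abs_le (φ x)
      have h2 := hM x
      rw [Real.norm_eq_abs] at h2
      simp
      linarith)
  refine ⟨g.comp (LinearMap.inr ℝ ℝ[X] C_c(ℝ, ℝ)), fun P φ h => ?_⟩
  have h1 : 0 ≤ g (P, -φ) := hgs _ fun x => by simpa using h x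
  have h2 : g (P, 0) = L P := hg ⟨(P, 0), P, rfl⟩
  have h3 : g (P, -φ) = g (P, 0) - g (0, φ) := by rw [← map_sub]; simp
  simp only [LinearMap.comp_apply, LinearMap.inr_apply]
  linarith

open CompactlySupported in
/-- **Hamburger's theorem**: a linear functional that is nonnegative on the nonnegative polynomials
is represented by a measure. -/
theorem exists_measure_moments_eq (L : ℝ[X] →ₗ[ℝ] ℝ)
    (hL : ∀ P : ℝ[X], (∀ x, 0 ≤ P.eval x) → 0 ≤ L P) :
    ∃ σ : Measure ℝ, ∀ P : ℝ[X], Integrable (fun x => P.eval x) σ ∧ ∫ x, P.eval x ∂σ = L P := by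
  obtain ⟨Φ, hΦ⟩ := exists_positive_extension L hL
  have hΦpos : ∀ f : C_c(ℝ, ℝ), 0 ≤ f → 0 ≤ Φ f := fun f hf => by
    have := hΦ 0 (-f) (fun x => by simpa using hf x)
    simpa using this
  let Λ : C_c(ℝ, ℝ) →ₚ[ℝ] ℝ := PositiveLinearMap.mk₀ Φ hΦpos
  let σ := RealRMK.rieszMeasure Λ
  have hσ : ∀ f : C_c(ℝ, ℝ), ∫ x, f x ∂σ = Φ f := fun f => RealRMK.integral_rieszMeasure Λ f
  have hlin : ∀ P : ℝ[X], (∀ x, 0 ≤ P.eval x) → Integrable (fun x => P.eval x) σ := by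
    intro P hP
    have hcont : ∀ k, Continuous fun x => cutoff k x * P.eval x := fun k =>
      (continuous_cutoff k).mul P.continuous
    refine ⟨P.continuous.aestronglyMeasurable, ?_⟩
    -- Fatou's lemma: the truncations increase the integral to no more than `L P`, by the domination
    -- property of `Φ`.
    have hb : ∫⁻ x, ‖P.eval x‖ₑ ∂σ ≤ ENNReal.ofReal (L P) := by
      have h1 : ∀ x, ‖P.eval x‖ₑ =
          liminf (fun k : ℕ => ENNReal.ofReal (cutoff k x * P.eval x)) atTop := fun x => by
        refine (Tendsto.liminf_eq ?_).symm
        rw [Real.enorm_of_nonneg (hP x)]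
        refine ENNReal.tendsto_ofReal ?_
        simpa using (tendsto_cutoff x).mul_const (P.eval x)
      simp_rw [h1]
      refine (lintegral_liminf_le fun k => (hcont k).measurable.ennreal_ofReal).trans ?_
      refine liminf_le_of_le (by isBoundedDefault) fun b hb => ?_
      obtain ⟨k, hk⟩ := hb.exists
      refine hk.trans ?_
      have hki : Integrable (fun x => cutoff k x * P.eval x) σ :=
        (hcont k).integrable_of_hasCompactSupport (truncatePoly k P).hasCompactSupport
      rw [← ofReal_integral_eq_lintegral_ofReal hki
        (ae_of_all _ fun x => mul_nonneg (cutoff_nonneg k x) (hP x))]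
      refine ENNReal.ofReal_le_ofReal ?_
      refine (hσ (truncatePoly k P)).trans_le (hΦ _ _ fun x => ?_)
      exact mul_le_of_le_one_left (hP x) (cutoff_le_one k x)
    exact hb.trans_lt ENNReal.ofReal_lt_top
  have hint : ∀ P : ℝ[X], Integrable (fun x => P.eval x) σ := fun P => by
    -- A general `P` is `((P + 1)² - P² - 1) / 2`, a combination of nonnegative polynomials.
    have h1 := hlin ((P + 1) ^ 2) fun x => by simp; positivity
    have h2 := hlin (P ^ 2) fun x => by simp; positivity
    have h3 := hlin 1 fun x => by simp
    have := ((h1.sub h2).sub h3).const_mul (1 / 2)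
    refine this.congr (ae_of_all _ fun x => ?_)
    simp
    ring
  refine ⟨σ, fun P => ⟨hint P, ?_⟩⟩
  have hlim : Tendsto (fun k => Φ (truncatePoly k P)) atTop (𝓝 (∫ x, P.eval x ∂σ)) := by
    simp_rw [← hσ, truncatePoly_apply]
    refine tendsto_integral_of_dominated_convergence (fun x => |P.eval x|)
      (fun k => ((continuous_cutoff k).mul P.continuous).aestronglyMeasurable) (hint P).abs
      (fun k => ae_of_all _ fun x => ?_) (ae_of_all _ fun x => ?_)
    · rw [norm_mul, Real.norm_eq_abs, Real.norm_eq_abs, abs_of_nonneg (cutoff_nonneg k x)]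
      exact mul_le_of_le_one_left (abs_nonneg _) (cutoff_le_one k x)
    · simpa using (tendsto_cutoff x).mul_const (P.eval x)
  refine tendsto_nhds_unique hlim ?_
  -- The truncation error lives on `|x| > k`, where `k ≤ x²`, and `|P| ≤ P² + 1`. So `R / k`
  -- dominates it, and the error under the functionals is at most `L R / k`.
  set R : ℝ[X] := X ^ 2 * (P ^ 2 + 1)
  have hbound : ∀ (k : ℕ) (x : ℝ), |(1 - cutoff k x) * P.eval x| * k ≤ R.eval x := fun k x => by
    have hc0 := cutoff_nonneg k x
    have hc1 := cutoff_le_one k x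
    have hR : R.eval x = x ^ 2 * (P.eval x ^ 2 + 1) := by simp [R]
    rw [hR, abs_mul, abs_of_nonneg (by linarith)]
    by_cases hx : |x| ≤ k
    · rw [cutoff_eq_one hx]; simp; positivity
    by_cases hk : k = 0
    · subst hk; simp; positivity
    have hk1 : (1 : ℝ) ≤ k := by exact_mod_cast Nat.pos_of_ne_zero hk
    push Not at hx
    have h1 : (k : ℝ) ≤ x ^ 2 := by rw [← sq_abs]; nlinarith
    have h2 : |P.eval x| ≤ P.eval x ^ 2 + 1 := by
      rw [← sq_abs]; nlinarith [sq_nonneg (|P.eval x| - 1), abs_nonneg (P.eval x)]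
    calc (1 - cutoff k x) * |P.eval x| * k ≤ 1 * |P.eval x| * k := by gcongr; linarith
      _ ≤ x ^ 2 * (P.eval x ^ 2 + 1) := by
          rw [one_mul, mul_comm]; gcongr
  have hle : ∀ k : ℕ, 1 ≤ k → |Φ (truncatePoly k P) - L P| ≤ L R / k := fun k hk => by
    have hk' : (0 : ℝ) < k := by exact_mod_cast hk
    have hmul : |Φ (truncatePoly k P) - L P| * k = |(Φ (truncatePoly k P) - L P) * k| := by
      rw [abs_mul, abs_of_pos hk']
    rw [le_div_iff₀ hk', hmul, abs_le]
    have key : ∀ x, |(1 - cutoff k x) * P.eval x * k| ≤ R.eval x := fun x => by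
      rw [abs_mul, abs_of_pos hk']; exact hbound k x
    have h1 := hΦ ((k : ℝ) • P + R) ((k : ℝ) • truncatePoly k P) fun x => by
      have := (abs_le.1 (key x)).1
      simp [truncatePoly_apply]
      linarith
    have h2 := hΦ (R - (k : ℝ) • P) (-((k : ℝ) • truncatePoly k P)) fun x => by
      have := (abs_le.1 (key x)).2
      simp [truncatePoly_apply]
      linarith
    simp only [map_add, map_sub, map_neg, map_smul, smul_eq_mul] at h1 h2
    constructor <;> linarith
  rw [← tendsto_sub_nhds_zero_iff]
  refine squeeze_zero_norm' (a := fun k : ℕ => L R / k) ?_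
    (tendsto_const_div_atTop_nhds_zero_nat _)
  filter_upwards [eventually_ge_atTop 1] with k hk using hle k hk

/-! ### Density of polynomials in `L²` of a determinate measure -/

/-- All moments of a measure on the line are finite. -/
def HasFiniteMoments (μ : Measure ℝ) : Prop := ∀ n : ℕ, Integrable (fun x : ℝ => x ^ n) μ

lemma HasFiniteMoments.integrable_eval {μ : Measure ℝ} (hμ : HasFiniteMoments μ) (P : ℝ[X]) :
    Integrable (fun x => P.eval x) μ := by
  simp_rw [eval_eq_sum_range]
  exact integrable_finsetSum _ fun i _ => (hμ i).const_mul _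

lemma HasFiniteMoments.memLp_eval {μ : Measure ℝ} (hμ : HasFiniteMoments μ) (P : ℝ[X]) :
    MemLp (fun x => P.eval x) 2 μ := by
  rw [memLp_two_iff_integrable_sq P.continuous.aestronglyMeasurable]
  exact (hμ.integrable_eval (P ^ 2)).congr (ae_of_all _ fun x => by simp)

lemma HasFiniteMoments.integrable_eval_mul {μ : Measure ℝ} (hμ : HasFiniteMoments μ)
    (P Q : ℝ[X]) : Integrable (fun x => P.eval x * Q.eval x) μ := by
  simpa using hμ.integrable_eval (P * Q)

lemma MeasureTheory.MemLp.inner_toLp {Ω : Type*} [MeasurableSpace Ω] {μ : Measure Ω}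
    {f g : Ω → ℝ} (hf : MemLp f 2 μ) (hg : MemLp g 2 μ) :
    inner ℝ (hf.toLp f) (hg.toLp g) = ∫ x, f x * g x ∂μ := by
  rw [L2.inner_def]
  refine integral_congr_ae ?_
  filter_upwards [hf.coeFn_toLp, hg.coeFn_toLp] with x h1 h2
  rw [h1, h2, real_inner_eq_re_inner]
  simp [mul_comm]

/-- The Cauchy-Schwarz inequality for integrals of real functions. -/
theorem MeasureTheory.MemLp.sq_integral_mul_le {Ω : Type*} [MeasurableSpace Ω] {μ : Measure Ω}
    {f g : Ω → ℝ} (hf : MemLp f 2 μ) (hg : MemLp g 2 μ) :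
    (∫ x, f x * g x ∂μ) ^ 2 ≤ (∫ x, f x ^ 2 ∂μ) * ∫ x, g x ^ 2 ∂μ := by
  have := real_inner_mul_inner_self_le (hf.toLp f) (hg.toLp g)
  simp only [MemLp.inner_toLp] at this
  simpa only [sq] using this

/-- `g` is a square-integrable function orthogonal to all polynomials. -/
def IsPolyOrthogonal (μ : Measure ℝ) (g : ℝ → ℝ) : Prop :=
  MemLp g 2 μ ∧ ∀ P : ℝ[X], ∫ x, g x * P.eval x ∂μ = 0

lemma memLp_mul_of_bdd {μ : Measure ℝ} {f r : ℝ → ℝ} (hf : MemLp f 2 μ) (hr : Continuous r)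
    (hb : ∀ x, |r x| ≤ 1) : MemLp (fun x => f x * r x) 2 μ := by
  refine hf.of_le (hf.1.mul hr.aestronglyMeasurable) (ae_of_all _ fun x => ?_)
  rw [norm_mul]
  exact mul_le_of_le_one_right (norm_nonneg _) (hb x)

lemma continuous_inv_one_add_sq : Continuous fun x : ℝ => (1 + x ^ 2)⁻¹ :=
  Continuous.inv₀ (by fun_prop) fun x => by positivity

lemma abs_inv_one_add_sq_le (x : ℝ) : |(1 + x ^ 2)⁻¹| ≤ 1 := by
  rw [abs_of_nonneg (by positivity)]
  exact inv_le_one_of_one_le₀ (by nlinarith [sq_nonneg x])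

lemma abs_mul_inv_one_add_sq_le (x : ℝ) : |x * (1 + x ^ 2)⁻¹| ≤ 1 := by
  rw [← div_eq_mul_inv, abs_div, abs_of_pos (by positivity : 0 < 1 + x ^ 2),
    div_le_one (by positivity), ← sq_abs]
  nlinarith [sq_nonneg (|x| - 1), abs_nonneg x]

lemma continuous_mul_inv_one_add_sq : Continuous fun x : ℝ => x * (1 + x ^ 2)⁻¹ :=
  continuous_id.mul continuous_inv_one_add_sq

/-- Division by `1 + X²`: the remainder records the value at `i`, and the multiple of `1 + X²`
disappears when paired with `g / (1 + x²)`. -/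
lemma Polynomial.exists_eq_one_add_X_sq_mul_add (P : ℝ[X]) :
    ∃ (Q : ℝ[X]) (a b : ℝ), P = (1 + X ^ 2) * Q + C b * X + C a := by
  induction P using Polynomial.induction_on' with
  | add p q hp hq =>
    obtain ⟨Q, a, b, h⟩ := hp
    obtain ⟨Q', a', b', h'⟩ := hq
    exact ⟨Q + Q', a + a', b + b', by rw [h, h']; simp only [C_add]; ring⟩
  | monomial n c =>
    induction n with
    | zero => exact ⟨0, c, 0, by simp⟩
    | succ n ih =>
      obtain ⟨Q, a, b, h⟩ := ih
      refine ⟨X * Q + C b, -b, a, ?_⟩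
      rw [← monomial_mul_X, h, C_neg]
      ring

lemma aeval_I_of_eq {P Q : ℝ[X]} {a b : ℝ} (h : P = (1 + X ^ 2) * Q + C b * X + C a) :
    aeval Complex.I P = a + b * Complex.I := by
  rw [h]
  simp
  ring

section Pairing

variable {μ : Measure ℝ} {g : ℝ → ℝ}

lemma IsPolyOrthogonal.integral_mul_eval_mul_inv [IsFiniteMeasure μ] (hg : IsPolyOrthogonal μ g)
    (hμ : HasFiniteMoments μ) (P : ℝ[X]) :
    ∫ x, g x * (P.eval x * (1 + x ^ 2)⁻¹) ∂μ =
      (aeval Complex.I P).re * ∫ x, g x * (1 + x ^ 2)⁻¹ ∂μ +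
        (aeval Complex.I P).im * ∫ x, g x * (x * (1 + x ^ 2)⁻¹) ∂μ := by
  obtain ⟨Q, a, b, h⟩ := P.exists_eq_one_add_X_sq_mul_add
  rw [aeval_I_of_eq h]
  have i1 : Integrable (fun x => g x * Q.eval x) μ := hg.1.integrable_mul (hμ.memLp_eval Q)
  have i2 : Integrable (fun x => g x * (1 + x ^ 2)⁻¹) μ :=
    (memLp_mul_of_bdd hg.1 continuous_inv_one_add_sq abs_inv_one_add_sq_le).integrable
      one_le_two
  have i3 : Integrable (fun x => g x * (x * (1 + x ^ 2)⁻¹)) μ :=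
    (memLp_mul_of_bdd hg.1 continuous_mul_inv_one_add_sq abs_mul_inv_one_add_sq_le).integrable
      one_le_two
  have : ∀ x, g x * (P.eval x * (1 + x ^ 2)⁻¹) =
      g x * Q.eval x + (a * (g x * (1 + x ^ 2)⁻¹) + b * (g x * (x * (1 + x ^ 2)⁻¹))) := fun x => by
    have : (1 + x ^ 2) ≠ 0 := by positivity
    rw [h]
    simp
    field_simp
    ring
  simp_rw [this]
  rw [integral_add i1 (by exact (i2.const_mul a).add (i3.const_mul b)),
    integral_add (i2.const_mul a) (i3.const_mul b), integral_const_mul, integral_const_mul, hg.2]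
  simp

lemma HasFiniteMoments.integrable_eval_mul_inv [IsFiniteMeasure μ]
    (hμ : HasFiniteMoments μ) (P : ℝ[X]) :
    Integrable (fun x => P.eval x * (1 + x ^ 2)⁻¹) μ :=
  (memLp_mul_of_bdd (hμ.memLp_eval P) continuous_inv_one_add_sq abs_inv_one_add_sq_le).integrable
      one_le_two

/-- Cauchy-Schwarz is applied to `P` and to `X * P`. Their values at `i` differ by the factor `i`,
so the two squared pairings add up to `|P(i)|²` times a constant independent of `P`. -/
lemma IsPolyOrthogonal.normSq_mul_le [IsFiniteMeasure μ] (hg : IsPolyOrthogonal μ g)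
    (hμ : HasFiniteMoments μ)
    (P : ℝ[X]) :
    Complex.normSq (aeval Complex.I P) * ((∫ x, g x * (1 + x ^ 2)⁻¹ ∂μ) ^ 2 +
        (∫ x, g x * (x * (1 + x ^ 2)⁻¹) ∂μ) ^ 2) ≤
      (∫ x, g x ^ 2 ∂μ) * ∫ x, (P ^ 2).eval x * (1 + x ^ 2)⁻¹ ∂μ := by
  have h1 := hg.integral_mul_eval_mul_inv hμ P
  have h2 := hg.integral_mul_eval_mul_inv hμ (X * P)
  have m1 : MemLp (fun x => P.eval x * (1 + x ^ 2)⁻¹) 2 μ :=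
    memLp_mul_of_bdd (hμ.memLp_eval P) continuous_inv_one_add_sq abs_inv_one_add_sq_le
  have m2 : MemLp (fun x => (X * P).eval x * (1 + x ^ 2)⁻¹) 2 μ :=
    memLp_mul_of_bdd (hμ.memLp_eval _) continuous_inv_one_add_sq abs_inv_one_add_sq_le
  have c1 := hg.1.sq_integral_mul_le m1
  have c2 := hg.1.sq_integral_mul_le m2
  -- The factor `1 + x²` coming from the sum cancels one of the two denominators.
  have h3 : (∫ x, (P.eval x * (1 + x ^ 2)⁻¹) ^ 2 ∂μ) +
      (∫ x, ((X * P).eval x * (1 + x ^ 2)⁻¹) ^ 2 ∂μ) =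
        ∫ x, (P ^ 2).eval x * (1 + x ^ 2)⁻¹ ∂μ := by
    rw [← integral_add m1.integrable_sq m2.integrable_sq]
    congr with x
    have : (1 + x ^ 2) ≠ 0 := by positivity
    simp
    field_simp
  rw [h1] at c1
  rw [h2] at c2
  rw [← h3, mul_add (∫ x, g x ^ 2 ∂μ), Complex.normSq_apply]
  simp only [map_mul, aeval_X, Complex.mul_re, Complex.mul_im, Complex.I_re, Complex.I_im] at c2
  refine le_trans (le_of_eq ?_) (add_le_add c1 c2)
  ring

/-- Otherwise evaluation at `i` is bounded in `L²(dμ / (1 + x²))`, which leaves room to perturb the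
moment functional and contradicts determinacy. -/
lemma IsPolyOrthogonal.integral_mul_inv_eq_zero [IsFiniteMeasure μ] (hg : IsPolyOrthogonal μ g)
    (hμ : IsMomentDeterminate μ) :
    ∫ x, g x * (1 + x ^ 2)⁻¹ ∂μ = 0 ∧ ∫ x, g x * (x * (1 + x ^ 2)⁻¹) ∂μ = 0 := by
  have hm : HasFiniteMoments μ := hμ.1
  have hcs := hg.normSq_mul_le hm
  set w := ∫ x, g x * (1 + x ^ 2)⁻¹ ∂μ
  set u := ∫ x, g x * (x * (1 + x ^ 2)⁻¹) ∂μ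
  set G := ∫ x, g x ^ 2 ∂μ
  have hG : 0 ≤ G := integral_nonneg fun x => sq_nonneg _
  suffices h : ¬ 0 < w ^ 2 + u ^ 2 by
    constructor <;> nlinarith [sq_nonneg w, sq_nonneg u]
  intro hpos
  -- The bound gives `t |A(i)|² ≤ ∫ A² / (1 + x²) dμ`; `G + 1` instead of `G` keeps the denominator
  -- positive.
  set t := (w ^ 2 + u ^ 2) / (G + 1) with ht
  have htpos : 0 < t := by positivity
  let L : ℝ[X] →ₗ[ℝ] ℝ :=
    { toFun := fun P => (∫ x, P.eval x * (1 + x ^ 2)⁻¹ ∂μ) - t * (aeval Complex.I P).re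
      map_add' := fun P Q => by
        simp only [eval_add, add_mul, map_add, Complex.add_re]
        rw [integral_add (hm.integrable_eval_mul_inv P) (hm.integrable_eval_mul_inv Q)]
        ring
      map_smul' := fun c P => by
        simp only [eval_smul, smul_eq_mul, mul_assoc, map_smul, Complex.real_smul,
          Complex.re_ofReal_mul, integral_const_mul, RingHom.id_apply]
        ring }
  have hLdef : ∀ P, L P = (∫ x, P.eval x * (1 + x ^ 2)⁻¹ ∂μ) - t * (aeval Complex.I P).re :=
    fun P => rfl
  have hsq : ∀ A : ℝ[X], 0 ≤ L (A ^ 2) := fun A => by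
    have h1 := hcs A
    have h2 : 0 ≤ ∫ x, (A ^ 2).eval x * (1 + x ^ 2)⁻¹ ∂μ :=
      integral_nonneg fun x => by simp; positivity
    have h3 : t * Complex.normSq (aeval Complex.I A) ≤
        ∫ x, (A ^ 2).eval x * (1 + x ^ 2)⁻¹ ∂μ := by
      rw [ht, div_mul_eq_mul_div, div_le_iff₀ (by positivity)]
      linarith
    have h4 : (aeval Complex.I (A ^ 2)).re ≤ Complex.normSq (aeval Complex.I A) := by
      rw [map_pow, sq, Complex.mul_re, Complex.normSq_apply]
      nlinarith [sq_nonneg (aeval Complex.I A).im]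
    rw [hLdef]
    nlinarith
  have hLpos : ∀ P : ℝ[X], (∀ x, 0 ≤ P.eval x) → 0 ≤ L P := fun P hP => by
    obtain ⟨A, B, rfl⟩ := P.exists_sq_add_sq_of_nonneg hP
    rw [map_add]
    exact add_nonneg (hsq A) (hsq B)
  obtain ⟨σ, hσ⟩ := exists_measure_moments_eq L hLpos
  set ρ : Measure ℝ := σ.withDensity fun x => ENNReal.ofReal (1 + x ^ 2) with hρ
  have hmeas : Measurable fun x : ℝ => ENNReal.ofReal (1 + x ^ 2) := by fun_prop
  have hlt : ∀ᵐ x ∂σ, ENNReal.ofReal (1 + x ^ 2) < ⊤ := ae_of_all _ fun x => ENNReal.ofReal_lt_top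
  have htr : ∀ x : ℝ, (ENNReal.ofReal (1 + x ^ 2)).toReal = 1 + x ^ 2 := fun x =>
    ENNReal.toReal_ofReal (by positivity)
  have hρint : ∀ n : ℕ, Integrable (fun x : ℝ => x ^ n) ρ := fun n => by
    rw [hρ, integrable_withDensity_iff_integrable_smul' hmeas hlt]
    simp_rw [htr]
    exact (hσ ((1 + X ^ 2) * X ^ n)).1.congr (ae_of_all _ fun x => by simp)
  have hfin : IsFiniteMeasure ρ := by
    have := hρint 0
    simp only [pow_zero] at this
    simpa [integrable_const_iff] using this
  -- The perturbation is invisible to the moments of `ρ`, since `(1 + X²) X ^ n` vanishes at `i`. It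
  -- is visible on the constant `1`, whose `σ`-integral is off by `t`.
  have hρμ : ρ = μ := hμ.2 ρ hρint fun n => by
    rw [hρ, integral_withDensity_eq_integral_toReal_smul hmeas hlt]
    simp_rw [htr]
    have h1 := (hσ ((1 + X ^ 2) * X ^ n)).2
    simp only [eval_mul, eval_add, eval_one, eval_pow, eval_X, hLdef, map_mul, map_add, map_one,
      map_pow, aeval_X, Complex.I_sq, add_neg_cancel, zero_mul, Complex.zero_re, mul_zero,
      sub_zero] at h1
    simp only [smul_eq_mul, h1]
    congr with x
    have : (1 + x ^ 2) ≠ 0 := by positivity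
    field_simp
  have h1 : ∫ x, (1 + x ^ 2)⁻¹ ∂ρ = L 1 := by
    rw [hρ, integral_withDensity_eq_integral_toReal_smul hmeas hlt, ← (hσ 1).2]
    simp_rw [htr]
    congr with x
    have : (1 + x ^ 2) ≠ 0 := by positivity
    simp [this]
  rw [hρμ, hLdef] at h1
  simp only [eval_one, one_mul, map_one, Complex.one_re, mul_one] at h1
  linarith

lemma IsPolyOrthogonal.mul_inv [IsFiniteMeasure μ] (hg : IsPolyOrthogonal μ g)
    (hμ : IsMomentDeterminate μ) :
    IsPolyOrthogonal μ (fun x => g x * (1 + x ^ 2)⁻¹) := by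
  refine ⟨memLp_mul_of_bdd hg.1 continuous_inv_one_add_sq abs_inv_one_add_sq_le, fun P => ?_⟩
  have h := hg.integral_mul_eval_mul_inv hμ.1 P
  rw [(hg.integral_mul_inv_eq_zero hμ).1, (hg.integral_mul_inv_eq_zero hμ).2] at h
  rw [mul_zero, mul_zero, add_zero] at h
  rw [← h]
  congr with x
  ring

lemma IsPolyOrthogonal.mul_mul_inv [IsFiniteMeasure μ] (hg : IsPolyOrthogonal μ g)
    (hμ : IsMomentDeterminate μ) :
    IsPolyOrthogonal μ (fun x => g x * (x * (1 + x ^ 2)⁻¹)) := by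
  refine ⟨memLp_mul_of_bdd hg.1 continuous_mul_inv_one_add_sq abs_mul_inv_one_add_sq_le,
    fun P => ?_⟩
  rw [← (hg.mul_inv hμ).2 (X * P)]
  congr with x
  simp
  ring

lemma MeasureTheory.MemLp.mul_boundedContinuous {f : ℝ → ℝ} (hf : MemLp f 2 μ)
    (φ : BoundedContinuousFunction ℝ ℝ) :
    MemLp (fun x => f x * φ x) 2 μ := by
  refine hf.of_le_mul (c := ‖φ‖) (hf.1.mul φ.continuous.aestronglyMeasurable)
    (ae_of_all _ fun x => ?_)
  rw [norm_mul, mul_comm]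
  exact mul_le_mul_of_nonneg_right (φ.norm_coe_le_norm x) (norm_nonneg _)

variable (μ) in
/-- The bounded continuous functions by which the orthogonal complement of the polynomials can be
multiplied. -/
def polyOrthogonalMultipliers (hμ : HasFiniteMoments μ) :
    StarSubalgebra ℝ (BoundedContinuousFunction ℝ ℝ) where
  -- Quantifying over every `g` orthogonal to the polynomials, not one fixed `g`, makes this set
  -- closed under products.
  carrier := {φ | ∀ g, IsPolyOrthogonal μ g → IsPolyOrthogonal μ fun x => g x * φ x}
  mul_mem' := by
    intro φ ψ hφ hψ g hg
    simpa [mul_assoc] using hψ _ (hφ g hg)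
  add_mem' := by
    intro φ ψ hφ hψ g hg
    refine ⟨hg.1.mul_boundedContinuous _, fun P => ?_⟩
    have i1 := (hφ g hg).1.integrable_mul (hμ.memLp_eval P)
    have i2 := (hψ g hg).1.integrable_mul (hμ.memLp_eval P)
    have := integral_add i1 i2
    simp only [Pi.mul_apply, (hφ g hg).2 P, (hψ g hg).2 P] at this
    simpa [mul_add, add_mul] using this
  algebraMap_mem' := by
    intro c g hg
    refine ⟨hg.1.mul_boundedContinuous _, fun P => ?_⟩
    have := hg.2 (C c * P)
    simpa [mul_assoc] using this
  star_mem' := by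
    intro φ hφ g hg
    simpa using hφ g hg

/-- **M. Riesz**: the polynomials are total in `L²(μ)` if `μ` is determined by its moments. -/
theorem IsPolyOrthogonal.ae_eq_zero [IsFiniteMeasure μ] (hg : IsPolyOrthogonal μ g)
    (hμ : IsMomentDeterminate μ) :
    g =ᵐ[μ] 0 := by
  have hgi : Integrable g μ := hg.1.integrable one_le_two
  have := isFiniteMeasure_withDensity_ofReal hgi.2
  have := isFiniteMeasure_withDensity_ofReal hgi.neg.2
  have hm1 : AEMeasurable (fun x => ENNReal.ofReal (g x)) μ := hgi.1.aemeasurable.ennreal_ofReal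
  have hm2 : AEMeasurable (fun x => ENNReal.ofReal ((-g) x)) μ :=
    hgi.neg.1.aemeasurable.ennreal_ofReal
  -- The positive and negative parts of `g` define two finite measures with equal integrals over a
  -- subalgebra that separates points, because `1 / (1 + x²)` and `x / (1 + x²)` together determine
  -- `x`.
  have heq : (μ.withDensity fun x => ENNReal.ofReal (g x)) =
      μ.withDensity fun x => ENNReal.ofReal ((-g) x) := by
    refine ext_of_forall_mem_subalgebra_integral_eq_of_polish (𝕜 := ℝ)
      (A := polyOrthogonalMultipliers μ hμ.1) ?_ ?_
    · intro x y hxy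
      by_contra hcon
      push Not at hcon
      have hsep : ∀ φ ∈ polyOrthogonalMultipliers μ hμ.1, φ x = φ y := fun φ hφ =>
        hcon _ ⟨_, ⟨φ, hφ, rfl⟩, rfl⟩
      have h1 := hsep (BoundedContinuousFunction.ofNormedAddCommGroup _ continuous_inv_one_add_sq 1
        abs_inv_one_add_sq_le) fun g hg => hg.mul_inv hμ
      have h2 := hsep (BoundedContinuousFunction.ofNormedAddCommGroup _
        continuous_mul_inv_one_add_sq 1 abs_mul_inv_one_add_sq_le) fun g hg => hg.mul_mul_inv hμ
      simp only [BoundedContinuousFunction.coe_ofNormedAddCommGroup] at h1 h2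
      rw [h1] at h2
      exact hxy (mul_right_cancel₀ (by positivity) h2)
    · intro φ hφ
      rw [integral_withDensity_eq_integral_toReal_smul₀ hm1
          (ae_of_all _ fun x => ENNReal.ofReal_lt_top),
        integral_withDensity_eq_integral_toReal_smul₀ hm2
          (ae_of_all _ fun x => ENNReal.ofReal_lt_top), ← sub_eq_zero]
      have hφg := (hφ g hg).2 1
      simp only [eval_one, mul_one] at hφg
      have i1 : Integrable (fun x => (ENNReal.ofReal (g x)).toReal • φ x) μ := by
        refine hgi.pos_part.mul_bdd (c := ‖φ‖) φ.continuous.aestronglyMeasurable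
          (ae_of_all _ φ.norm_coe_le_norm) |>.congr (ae_of_all _ fun x => ?_)
        simp [ENNReal.toReal_ofReal']
      have i2 : Integrable (fun x => (ENNReal.ofReal ((-g) x)).toReal • φ x) μ := by
        refine hgi.neg.pos_part.mul_bdd (c := ‖φ‖) φ.continuous.aestronglyMeasurable
          (ae_of_all _ φ.norm_coe_le_norm) |>.congr (ae_of_all _ fun x => ?_)
        simp [ENNReal.toReal_ofReal']
      rw [← integral_sub i1 i2, ← hφg]
      congr with x
      simp only [ENNReal.toReal_ofReal', Pi.neg_apply, smul_eq_mul]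
      rcases le_total (g x) 0 with h | h
      · rw [max_eq_right h, max_eq_left (by linarith)]; ring
      · rw [max_eq_left h, max_eq_right (by linarith)]; ring
  rw [withDensity_eq_iff hm1 hm2 (by
    have h := measure_ne_top (μ.withDensity fun x => ENNReal.ofReal (g x)) Set.univ
    rwa [withDensity_apply _ MeasurableSet.univ, setLIntegral_univ] at h)] at heq
  filter_upwards [heq] with x hx
  rcases le_total (g x) 0 with h | h
  · rw [ENNReal.ofReal_of_nonpos h, eq_comm, ENNReal.ofReal_eq_zero, Pi.neg_apply] at hx
    exact le_antisymm h (neg_nonpos.1 hx)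
  · rw [ENNReal.ofReal_of_nonpos (p := (-g) x) (by simpa using h), ENNReal.ofReal_eq_zero] at hx
    exact le_antisymm hx h

end Pairing

/-! ### Totality of products of polynomials -/

lemma memLp_eval_mul_eval {μ ν : Measure ℝ} [IsFiniteMeasure μ] [IsFiniteMeasure ν]
    (hμ : HasFiniteMoments μ) (hν : HasFiniteMoments ν) (P Q : ℝ[X]) :
    MemLp (fun z : ℝ × ℝ => P.eval z.1 * Q.eval z.2) 2 (μ.prod ν) := by
  rw [memLp_two_iff_integrable_sq (by fun_prop)]
  refine ((hμ.integrable_eval (P ^ 2)).mul_prod (hν.integrable_eval (Q ^ 2))).congr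
    (ae_of_all _ fun z => ?_)
  simp [mul_pow]

/-- A square-integrable function that is orthogonal to all products of polynomials vanishes. -/
theorem ae_eq_zero_of_forall_integral_mul_eval_eq_zero {μ ν : Measure ℝ} [IsFiniteMeasure μ]
    [IsFiniteMeasure ν] (hμ : IsMomentDeterminate μ) (hν : IsMomentDeterminate ν)
    {G : ℝ × ℝ → ℝ} (hG : MemLp G 2 (μ.prod ν))
    (h : ∀ P Q : ℝ[X], ∫ z, G z * (P.eval z.1 * Q.eval z.2) ∂(μ.prod ν) = 0) :
    G =ᵐ[μ.prod ν] 0 := by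
  have hGsq : Integrable (fun z => G z ^ 2) (μ.prod ν) := hG.integrable_sq
  have hsec : ∀ᵐ x ∂μ, MemLp (fun y => G (x, y)) 2 ν := by
    filter_upwards [hGsq.prod_right_ae, hG.1.prodMk_left] with x h1 h2
    exact (memLp_two_iff_integrable_sq h2).2 h1
  have hPQ : ∀ P Q : ℝ[X], Integrable (fun z => G z * (P.eval z.1 * Q.eval z.2)) (μ.prod ν) := by
    intro P Q
    exact hG.integrable_mul (memLp_eval_mul_eval hμ.1 hν.1 P Q)
  -- For fixed `Q`, the partial integral is a function in `L²(μ)` orthogonal to all polynomials in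
  -- `x`.
  have hmarg : ∀ Q : ℝ[X], (fun x => ∫ y, G (x, y) * Q.eval y ∂ν) =ᵐ[μ] 0 := fun Q => by
    refine IsPolyOrthogonal.ae_eq_zero ⟨?_, fun P => ?_⟩ hμ
    · have hmeas : AEStronglyMeasurable (fun x => ∫ y, G (x, y) * Q.eval y ∂ν) μ := by
        have : AEStronglyMeasurable (fun z : ℝ × ℝ => G z * Q.eval z.2) (μ.prod ν) :=
          hG.1.mul (by fun_prop)
        exact this.integral_prod_right'
      rw [memLp_two_iff_integrable_sq hmeas]
      refine (hGsq.integral_prod_left.mul_const (∫ y, Q.eval y ^ 2 ∂ν)).mono' (hmeas.pow 2) ?_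
      filter_upwards [hsec] with x hx
      rw [Real.norm_of_nonneg (sq_nonneg _)]
      exact hx.sq_integral_mul_le (HasFiniteMoments.memLp_eval hν.1 Q)
    · rw [← h P Q, integral_prod _ (hPQ P Q)]
      congr with x
      rw [← integral_mul_const]
      congr with y
      ring
  -- Restricting to the countably many monomials gives one null set outside which the whole section
  -- is orthogonal to the polynomials.
  have hall : ∀ᵐ x ∂μ, ∀ n : ℕ, ∫ y, G (x, y) * (X ^ n : ℝ[X]).eval y ∂ν = 0 :=
    ae_all_iff.2 fun n => hmarg (X ^ n)
  have hzero : ∀ᵐ x ∂μ, ∫ y, G (x, y) ^ 2 ∂ν = 0 := by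
    filter_upwards [hall, hsec] with x h1 h2
    have h3 : IsPolyOrthogonal ν fun y => G (x, y) := by
      refine ⟨h2, fun P => ?_⟩
      simp_rw [eval_eq_sum_range, Finset.mul_sum]
      rw [integral_finsetSum]
      · refine Finset.sum_eq_zero fun i _ => ?_
        have := h1 i
        simp only [eval_pow, eval_X] at this
        simp_rw [mul_left_comm]
        rw [integral_const_mul, this, mul_zero]
      · intro i _
        have := h2.integrable_mul (HasFiniteMoments.memLp_eval hν.1 (C (P.coeff i) * X ^ i))
        exact this.congr (ae_of_all _ fun y => by simp)
    have h4 := h3.ae_eq_zero hν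
    refine integral_eq_zero_of_ae ?_
    filter_upwards [h4] with y hy
    rw [hy]
    simp
  have hint : ∫ z, G z ^ 2 ∂(μ.prod ν) = 0 := by
    rw [integral_prod _ hGsq]
    exact integral_eq_zero_of_ae hzero
  rw [integral_eq_zero_iff_of_nonneg (fun z => sq_nonneg _) hGsq] at hint
  filter_upwards [hint] with z hz
  simpa using hz

/-! ### Orthogonal and diagonal expansions -/

/-- The expansion of a vector along a total orthogonal family, some of whose members may vanish. -/
theorem hasSum_orthogonal_expansion {H ι : Type*} [NormedAddCommGroup H] [InnerProductSpace ℝ H]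
    [CompleteSpace H] (v : ι → H) (hv : Pairwise fun i j => inner ℝ (v i) (v j) = 0)
    (htot : ∀ x, (∀ i, inner ℝ (v i) x = 0) → x = 0) (x : H) :
    HasSum (fun i => (inner ℝ (v i) x / ‖v i‖ ^ 2) • v i) x := by
  -- Null members, which occur for finitely supported marginals, are dropped before normalizing;
  -- their terms in the sum are zero.
  let s : Set ι := {i | v i ≠ 0}
  let e : s → H := fun i => (‖v i‖⁻¹ : ℝ) • v i
  have he : Orthonormal ℝ e := by
    refine ⟨fun i => ?_, fun i j hij => ?_⟩
    · rw [norm_smul, norm_inv, norm_norm, inv_mul_cancel₀ (norm_ne_zero_iff.2 i.2)]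
    · have := hv (fun h => hij (Subtype.ext h) : (i : ι) ≠ j)
      simp [e, inner_smul_left, inner_smul_right, this]
  have hspan : (Submodule.span ℝ (Set.range e))ᗮ = ⊥ := by
    rw [Submodule.eq_bot_iff]
    intro y hy
    refine htot y fun i => ?_
    by_cases hi : v i = 0
    · rw [hi, inner_zero_left]
    · have := (Submodule.mem_orthogonal _ _).1 hy (e ⟨i, hi⟩) (Submodule.subset_span ⟨_, rfl⟩)
      rw [inner_smul_left] at this
      exact (mul_eq_zero.1 this).resolve_left (by simpa using hi)
  have hb := (HilbertBasis.mkOfOrthogonalEqBot he hspan).hasSum_repr x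
  have hsupp : (Function.support fun i => (inner ℝ (v i) x / ‖v i‖ ^ 2) • v i) ⊆ s := by
    intro i hi h
    exact hi (by simp only [h, smul_zero])
  rw [← hasSum_subtype_iff_of_support_subset hsupp]
  refine hb.congr_fun fun i => ?_
  rw [HilbertBasis.repr_apply_apply, HilbertBasis.coe_mkOfOrthogonalEqBot]
  simp only [e, inner_smul_left, smul_smul, Function.comp, conj_trivial]
  congr 1
  field_simp

/-- The expansion of a polynomial along a sequence of polynomials with one member of each degree. -/
lemma Polynomial.exists_eq_sum_of_degree_eq {α : ℕ → ℝ[X]} (hα : ∀ n, (α n).degree = n) (n : ℕ)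
    (P : ℝ[X]) (hP : P.degree ≤ n) :
    ∃ d : ℕ → ℝ, P = ∑ k ∈ Finset.range (n + 1), C (d k) * α k ∧
      P.coeff n = d n * (α n).leadingCoeff := by
  have hnd : ∀ n, (α n).natDegree = n := fun n => natDegree_eq_of_degree_eq_some (hα n)
  have hlc : ∀ n, (α n).leadingCoeff ≠ 0 := fun n => by
    rw [leadingCoeff_ne_zero]
    rintro h
    simpa [h] using hα n
  induction n generalizing P with
  | zero =>
    refine ⟨fun _ => P.coeff 0 / (α 0).leadingCoeff, ?_, by field_simp [hlc 0]⟩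
    have h1 := eq_C_of_degree_le_zero hP
    have h2 := eq_C_of_degree_le_zero (hα 0).le
    have h3 : (α 0).leadingCoeff = (α 0).coeff 0 := by rw [leadingCoeff, hnd]
    have h4 := hlc 0
    rw [h3] at h4 ⊢
    simp only [Finset.range_one, zero_add, Finset.sum_singleton]
    conv_rhs => rw [h2, ← C_mul]
    rw [coeff_C_zero, div_mul_cancel₀ _ h4]
    exact h1
  | succ n ih =>
    set t := P.coeff (n + 1) / (α (n + 1)).leadingCoeff with ht
    have htl : t * (α (n + 1)).leadingCoeff = P.coeff (n + 1) := by
      rw [ht]; field_simp [hlc (n + 1)]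
    obtain ⟨d, hd, -⟩ := ih (P - C t * α (n + 1)) (by
      rw [degree_le_iff_coeff_zero]
      intro m hm
      rw [Nat.cast_lt] at hm
      rcases Nat.lt_or_ge (n + 1) m with h | h
      · have h1 : P.coeff m = 0 := coeff_eq_zero_of_degree_lt (hP.trans_lt (Nat.cast_lt.2 h))
        have h2 : (α (n + 1)).coeff m = 0 :=
          coeff_eq_zero_of_degree_lt ((hα _).trans_lt (Nat.cast_lt.2 h))
        simp [h1, h2]
      · obtain rfl : m = n + 1 := by omega
        rw [coeff_sub, coeff_C_mul, ← htl, leadingCoeff, hnd, sub_self])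
    refine ⟨Function.update d (n + 1) t, ?_, by rw [Function.update_self, htl]⟩
    rw [Finset.sum_range_succ, Function.update_self, ← sub_eq_iff_eq_add, hd]
    refine Finset.sum_congr rfl fun k hk => ?_
    rw [Function.update_of_ne (by simp at hk; omega)]

/-- A function in `L²(μ ⊗ ν)` whose off-diagonal Fourier coefficients with respect to orthogonal
polynomials vanish is the sum of its diagonal Fourier series. -/
theorem exists_tendsto_eLpNorm_diagonal_expansion {μ ν : Measure ℝ} [IsFiniteMeasure μ]
    [IsFiniteMeasure ν] (hμ : IsMomentDeterminate μ) (hν : IsMomentDeterminate ν)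
    {α β : ℕ → ℝ[X]} (hα : IsOrthogonalPolySeq μ α) (hβ : IsOrthogonalPolySeq ν β)
    {G : ℝ × ℝ → ℝ} (hG : MemLp G 2 (μ.prod ν))
    (h : ∀ m n, m ≠ n → ∫ z, G z * ((α m).eval z.1 * (β n).eval z.2) ∂(μ.prod ν) = 0) :
    ∃ c : ℕ → ℝ, Tendsto (fun N : ℕ => eLpNorm (fun z : ℝ × ℝ => G z -
      ∑ n ∈ Finset.range N, c n * (α n).eval z.1 * (β n).eval z.2) 2 (μ.prod ν)) atTop (𝓝 0) := by
  have hm := fun i : ℕ × ℕ => memLp_eval_mul_eval (μ := μ) (ν := ν) hμ.1 hν.1 (α i.1) (β i.2)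
  let v : ℕ × ℕ → Lp ℝ 2 (μ.prod ν) := fun i => (hm i).toLp _
  have hv : Pairwise fun i j => inner ℝ (v i) (v j) = 0 := by
    rintro ⟨i, i'⟩ ⟨j, j'⟩ hij
    rw [(hm _).inner_toLp (hm _)]
    have : ∀ z : ℝ × ℝ, (α i).eval z.1 * (β i').eval z.2 * ((α j).eval z.1 * (β j').eval z.2) =
      ((α i).eval z.1 * (α j).eval z.1) * ((β i').eval z.2 * (β j').eval z.2) := fun z => by ring
    simp_rw [this]
    rw [integral_prod_mul (fun x => (α i).eval x * (α j).eval x)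
      (fun y => (β i').eval y * (β j').eval y)]
    by_cases hi : i = j
    · rw [hβ.2 i' j' (by rintro rfl; exact hij (by rw [hi])), mul_zero]
    · rw [hα.2 i j hi, zero_mul]
  have htot : ∀ x, (∀ i, inner ℝ (v i) x = 0) → x = 0 := by
    intro x hx
    have hxm := Lp.memLp x
    have hx' : ∀ i j, ∫ z, x z * ((α i).eval z.1 * (β j).eval z.2) ∂(μ.prod ν) = 0 := fun i j => by
      have := hx (i, j)
      rw [real_inner_comm, ← Lp.toLp_coeFn x hxm, hxm.inner_toLp (hm _)] at this
      exact this
    rw [Lp.eq_zero_iff_ae_eq_zero]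
    refine ae_eq_zero_of_forall_integral_mul_eval_eq_zero hμ hν hxm fun P Q => ?_
    obtain ⟨d, hd, -⟩ := exists_eq_sum_of_degree_eq hα.1 P.natDegree P degree_le_natDegree
    obtain ⟨d', hd', -⟩ := exists_eq_sum_of_degree_eq hβ.1 Q.natDegree Q degree_le_natDegree
    have : ∀ z : ℝ × ℝ, x z * (P.eval z.1 * Q.eval z.2) =
        ∑ i ∈ Finset.range (P.natDegree + 1), ∑ j ∈ Finset.range (Q.natDegree + 1),
          d i * d' j * (x z * ((α i).eval z.1 * (β j).eval z.2)) := fun z => by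
      conv_lhs => rw [hd, hd', eval_finsetSum, eval_finsetSum, Finset.sum_mul_sum, Finset.mul_sum]
      refine Finset.sum_congr rfl fun i _ => ?_
      rw [Finset.mul_sum]
      refine Finset.sum_congr rfl fun j _ => ?_
      simp only [eval_mul, eval_C]
      ring
    have hi : ∀ i j, Integrable
        (fun z => d i * d' j * (x z * ((α i).eval z.1 * (β j).eval z.2))) (μ.prod ν) := fun i j =>
      (hxm.integrable_mul (hm (i, j))).const_mul _
    simp_rw [this]
    rw [integral_finsetSum _ fun i _ => integrable_finsetSum _ fun j _ => hi i j]
    refine Finset.sum_eq_zero fun i _ => ?_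
    rw [integral_finsetSum _ fun j _ => hi i j]
    refine Finset.sum_eq_zero fun j _ => ?_
    rw [integral_const_mul, hx', mul_zero]
  have hsum := hasSum_orthogonal_expansion v hv htot (hG.toLp G)
  have hoff : ∀ i : ℕ × ℕ, i ∉ Set.range (fun n : ℕ => (n, n)) →
      (inner ℝ (v i) (hG.toLp G) / ‖v i‖ ^ 2) • v i = 0 := by
    rintro ⟨i, j⟩ hij
    have : i ≠ j := by rintro rfl; exact hij ⟨i, rfl⟩
    rw [real_inner_comm, hG.inner_toLp (hm (i, j)), h i j this, zero_div, zero_smul]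
  have hinj : Function.Injective fun n : ℕ => (n, n) := fun a b hab => (Prod.ext_iff.1 hab).1
  rw [← hinj.hasSum_iff hoff] at hsum
  have ht := hsum.tendsto_sum_nat
  refine ⟨fun n => inner ℝ (v (n, n)) (hG.toLp G) / ‖v (n, n)‖ ^ 2, ?_⟩
  set c := fun n => inner ℝ (v (n, n)) (hG.toLp G) / ‖v (n, n)‖ ^ 2
  have ht2 := (Lp.tendsto_Lp_iff_tendsto_eLpNorm _ _ hG).1 ht
  refine ht2.congr fun N => ?_
  rw [← eLpNorm_neg]
  refine eLpNorm_congr_ae ?_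
  have hcoe : ∀ N, (⇑(∑ n ∈ Finset.range N, c n • v (n, n)) : ℝ × ℝ → ℝ) =ᵐ[μ.prod ν]
      fun z => ∑ n ∈ Finset.range N, c n * (α n).eval z.1 * (β n).eval z.2 := fun N => by
    -- Only finite sums have to be matched with their representatives almost everywhere.
    induction N with
    | zero =>
      filter_upwards [Lp.coeFn_zero ℝ 2 (μ.prod ν)] with z hz
      simpa using hz
    | succ N ih =>
      rw [Finset.sum_range_succ]
      filter_upwards [ih, Lp.coeFn_add (∑ n ∈ Finset.range N, c n • v (n, n)) (c N • v (N, N)),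
        Lp.coeFn_smul (c N) (v (N, N)), (hm (N, N)).coeFn_toLp] with z h1 h2 h3 h4
      rw [h2, Pi.add_apply, h1, h3, Pi.smul_apply, h4, Finset.sum_range_succ, smul_eq_mul,
        mul_assoc (c N)]
  filter_upwards [hcoe N] with z hz
  simp only [Pi.neg_apply, Pi.sub_apply, neg_sub]
  exact congrArg _ hz

/-! ### Finite supports and existence of orthogonal polynomials -/

/-- A measure on the line has at most `n` points in its support if and only if some polynomial of
degree `n` vanishes almost everywhere. -/
theorem support_encard_le_iff {μ : Measure ℝ} (n : ℕ) :
    μ.support.encard ≤ n ↔ ∃ P : ℝ[X], P.degree = n ∧ ∀ᵐ x ∂μ, P.eval x = 0 := by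
  constructor
  · intro h
    have hfin : μ.support.Finite := Set.finite_of_encard_le_coe h
    have hcard : hfin.toFinset.card ≤ n := by
      rw [hfin.encard_eq_coe_toFinset_card] at h
      exact_mod_cast h
    -- The power of `X` only pads the degree up to exactly `n`.
    refine ⟨(∏ a ∈ hfin.toFinset, (X - C a)) * X ^ (n - hfin.toFinset.card), ?_, ?_⟩
    · rw [degree_mul, degree_prod, degree_X_pow]
      simp only [degree_X_sub_C, Finset.sum_const, nsmul_eq_mul, mul_one]
      rw [← Nat.cast_add]
      congr 1
      omega
    · filter_upwards [μ.support_mem_ae] with x hx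
      rw [eval_mul, eval_prod, Finset.prod_eq_zero (hfin.mem_toFinset.2 hx) (by simp), zero_mul]
  · rintro ⟨P, hP, h0⟩
    have hP0 : P ≠ 0 := by rintro rfl; simp at hP
    have hsub : μ.support ⊆ (P.roots.toFinset : Set ℝ) := by
      refine Measure.support_subset_of_isClosed P.roots.toFinset.finite_toSet.isClosed ?_
      filter_upwards [h0] with x hx
      simpa [hP0] using hx
    refine (Set.encard_le_encard hsub).trans ?_
    rw [Set.encard_coe_eq_coe_finsetCard]
    have h1 := P.roots.toFinset_card_le
    have h2 := P.card_roots'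
    rw [natDegree_eq_of_degree_eq_some hP] at h2
    exact_mod_cast h1.trans h2

lemma HasFiniteMoments.ae_eval_eq_zero_of_integral_eq_zero {μ : Measure ℝ}
    (hμ : HasFiniteMoments μ) {P : ℝ[X]} (h : ∫ x, P.eval x * P.eval x ∂μ = 0) :
    ∀ᵐ x ∂μ, P.eval x = 0 := by
  rw [integral_eq_zero_iff_of_nonneg (fun x => mul_self_nonneg _)
    (hμ.integrable_eval_mul P P)] at h
  filter_upwards [h] with x hx
  simpa using hx

/-- Orthogonal polynomials are orthogonal to the polynomials of lower degree. -/
lemma IsOrthogonalPolySeq.integral_mul_eq_zero {μ : Measure ℝ} (hμ : HasFiniteMoments μ)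
    {α : ℕ → ℝ[X]} (hα : IsOrthogonalPolySeq μ α) {n : ℕ} {P : ℝ[X]} (hP : P.degree < n) :
    ∫ x, P.eval x * (α n).eval x ∂μ = 0 := by
  by_cases hP0 : P = 0
  · simp [hP0]
  have hd : P.natDegree < n := (natDegree_lt_iff_degree_lt hP0).2 hP
  obtain ⟨d, hd', -⟩ := exists_eq_sum_of_degree_eq hα.1 P.natDegree P degree_le_natDegree
  have : ∀ x, P.eval x * (α n).eval x =
      ∑ k ∈ Finset.range (P.natDegree + 1), d k * ((α k).eval x * (α n).eval x) := fun x => by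
    conv_lhs => rw [hd', eval_finsetSum, Finset.sum_mul]
    simp [mul_assoc]
  simp_rw [this]
  rw [integral_finsetSum _ fun i _ => (hμ.integrable_eval_mul _ _).const_mul _]
  refine Finset.sum_eq_zero fun k hk => ?_
  rw [integral_const_mul, hα.2 k n (by simp at hk; omega), mul_zero]

/-- If a polynomial of degree `n` vanishes almost everywhere, then so does the orthogonal
polynomial of degree `n`. -/
lemma IsOrthogonalPolySeq.ae_eval_eq_zero {μ : Measure ℝ} (hμ : HasFiniteMoments μ)
    {α : ℕ → ℝ[X]} (hα : IsOrthogonalPolySeq μ α) {n : ℕ} {r : ℝ[X]} (hr : r.degree = n)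
    (hr0 : ∀ᵐ x ∂μ, r.eval x = 0) : ∀ᵐ x ∂μ, (α n).eval x = 0 := by
  refine hμ.ae_eval_eq_zero_of_integral_eq_zero ?_
  have hlr : r.leadingCoeff ≠ 0 := by
    rw [leadingCoeff_ne_zero]
    rintro rfl
    simp at hr
  set t := (α n).leadingCoeff / r.leadingCoeff
  have hne : α n ≠ 0 := by
    intro h
    simpa [h] using hα.1 n
  have ht : t ≠ 0 := div_ne_zero (leadingCoeff_ne_zero.2 hne) hlr
  -- The difference has lower degree, so it is orthogonal to `α n`; yet it equals `α n` almost
  -- everywhere.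
  have hlt : (α n - C t * r).degree < n := by
    rw [← hα.1 n]
    refine degree_sub_lt_left ?_ hne ?_
    · rw [degree_C_mul ht, hr, hα.1]
    · rw [leadingCoeff_mul, leadingCoeff_C, div_mul_cancel₀ _ hlr]
  rw [← hα.integral_mul_eq_zero hμ hlt]
  refine integral_congr_ae ?_
  filter_upwards [hr0] with x hx
  simp [hx]

lemma Polynomial.degree_C_mul_le_degree (t : ℝ) (P : ℝ[X]) : (C t * P).degree ≤ P.degree := by
  rw [← smul_eq_C_mul]
  exact degree_smul_le t P

/-- The Gram-Schmidt process for the monomials. -/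
noncomputable def gramSchmidtPoly (μ : Measure ℝ) (n : ℕ) : ℝ[X] :=
  X ^ n - ∑ k : Fin n, C ((∫ x, x ^ n * (gramSchmidtPoly μ k).eval x ∂μ) /
    ∫ x, (gramSchmidtPoly μ k).eval x * (gramSchmidtPoly μ k).eval x ∂μ) * gramSchmidtPoly μ k
termination_by n
decreasing_by all_goals exact k.2

lemma degree_gramSchmidtPoly (μ : Measure ℝ) (n : ℕ) : (gramSchmidtPoly μ n).degree = n := by
  induction n using Nat.strong_induction_on with
  | _ n ih =>
  rw [gramSchmidtPoly, degree_sub_eq_left_of_degree_lt, degree_X_pow]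
  rw [degree_X_pow]
  rw [← mem_degreeLT]
  refine Submodule.sum_mem _ fun k _ => mem_degreeLT.2 ?_
  refine (degree_C_mul_le_degree _ _).trans_lt ?_
  rw [ih k k.2]
  exact_mod_cast k.2

/-- Every measure with finite moments has orthogonal polynomials. -/
theorem HasFiniteMoments.isOrthogonalPolySeq_gramSchmidtPoly {μ : Measure ℝ}
    (hμ : HasFiniteMoments μ) : IsOrthogonalPolySeq μ (gramSchmidtPoly μ) := by
  refine ⟨degree_gramSchmidtPoly μ, ?_⟩
  have key : ∀ n, ∀ m < n,
      ∫ x, (gramSchmidtPoly μ n).eval x * (gramSchmidtPoly μ m).eval x ∂μ = 0 := by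
    intro n
    induction n using Nat.strong_induction_on with
    | _ n ih =>
    intro m hm
    set γ := gramSchmidtPoly μ with hγ
    set t : ℕ → ℝ := fun k => (∫ x, x ^ n * (γ k).eval x ∂μ) / ∫ x, (γ k).eval x * (γ k).eval x ∂μ
    have hn : γ n = X ^ n - ∑ k : Fin n, C (t k) * γ k := by
      rw [hγ, gramSchmidtPoly]
    have h1 : ∀ x, (γ n).eval x * (γ m).eval x =
        x ^ n * (γ m).eval x - ∑ k : Fin n, t k * ((γ k).eval x * (γ m).eval x) := fun x => by
      rw [hn]
      simp [eval_finsetSum, sub_mul, Finset.sum_mul, mul_assoc]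
    have i1 : Integrable (fun x => x ^ n * (γ m).eval x) μ :=
      (hμ.integrable_eval_mul (X ^ n) (γ m)).congr (ae_of_all _ fun x => by simp)
    simp_rw [h1]
    rw [integral_sub i1 (integrable_finsetSum _
      fun k _ => (hμ.integrable_eval_mul _ _).const_mul _),
      integral_finsetSum _ fun k _ => (hμ.integrable_eval_mul _ _).const_mul _,
      Finset.sum_eq_single (⟨m, hm⟩ : Fin n), integral_const_mul]
    · by_cases h0 : ∫ x, (γ m).eval x * (γ m).eval x ∂μ = 0
      · have h2 : ∫ x, x ^ n * (γ m).eval x ∂μ = 0 := by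
          refine integral_eq_zero_of_ae ?_
          filter_upwards [hμ.ae_eval_eq_zero_of_integral_eq_zero h0] with x hx
          simp [hx]
        simp only [h0, h2, mul_zero, sub_zero]
      · simp only [t]
        rw [div_mul_cancel₀ _ h0, sub_self]
    · intro k _ hk
      have hkm : (k : ℕ) ≠ m := fun h => hk (Fin.ext h)
      rw [integral_const_mul]
      rcases lt_or_gt_of_ne hkm with h | h
      · have := ih m hm k h
        simp_rw [mul_comm ((γ k).eval _)]
        rw [this, mul_zero]
      · rw [ih k k.2 m h, mul_zero]
    · intro h
      exact absurd (Finset.mem_univ _) h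
  intro m n hmn
  rcases lt_or_gt_of_ne hmn with h | h
  · simp_rw [mul_comm ((gramSchmidtPoly μ m).eval _)]
    exact key n m h
  · exact key m n h

/-! ### Expansions against conditional moments -/

/-- `E(a ^ n | b) = p(b)` almost surely. -/
def CondMomentEq (F : Measure (ℝ × ℝ)) (a b : ℝ × ℝ → ℝ) (n : ℕ) (p : ℝ[X]) : Prop :=
  F[fun z => a z ^ n | MeasurableSpace.comap b inferInstance] =ᵐ[F] fun z => p.eval (b z)

/-- `a` and `b` are random variables with laws `μ` and `ν` under `F`, and they are independent
with the same laws under `π`. -/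
structure IsCoupling (F π : Measure (ℝ × ℝ)) (a b : ℝ × ℝ → ℝ) (μ ν : Measure ℝ) : Prop where
  left : MeasurePreserving a F μ
  right : MeasurePreserving b F ν
  prod : MeasurePreserving (fun z => (a z, b z)) π (μ.prod ν)

/-- With the swapped version below, each statement about `E(a ^ n | b)` serves for both orders of
the coordinates, over the same product measure. -/
lemma isCoupling_fst_snd (F : Measure (ℝ × ℝ)) :
    IsCoupling F (F.fst.prod F.snd) Prod.fst Prod.snd F.fst F.snd :=
  ⟨⟨measurable_fst, rfl⟩, ⟨measurable_snd, rfl⟩, MeasurePreserving.id _⟩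

lemma isCoupling_snd_fst (F : Measure (ℝ × ℝ)) [IsProbabilityMeasure F] :
    IsCoupling F (F.fst.prod F.snd) Prod.snd Prod.fst F.snd F.fst :=
  ⟨⟨measurable_snd, rfl⟩, ⟨measurable_fst, rfl⟩, ⟨measurable_swap, Measure.prod_swap⟩⟩

lemma MeasureTheory.MeasurePreserving.integral_comp_of_measurable {Ω Ω' : Type*}
    [MeasurableSpace Ω] [MeasurableSpace Ω'] {μ : Measure Ω} {ν : Measure Ω'} {f : Ω → Ω'}
    (hf : MeasurePreserving f μ ν) {φ : Ω' → ℝ} (hφ : Measurable φ) :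
    ∫ x, φ (f x) ∂μ = ∫ y, φ y ∂ν := by
  rw [← hf.map_eq, integral_map hf.measurable.aemeasurable hφ.aestronglyMeasurable]

/-- Continuity of the inner product in `L²`; it allows a mean-square expansion to be paired term by
term. -/
lemma tendsto_integral_mul_of_tendsto_eLpNorm {Ω : Type*} [MeasurableSpace Ω] {μ : Measure Ω}
    {K φ : Ω → ℝ} {S : ℕ → Ω → ℝ} (hK : MemLp K 2 μ) (hS : ∀ n, MemLp (S n) 2 μ)
    (hφ : MemLp φ 2 μ) (h : Tendsto (fun n => eLpNorm (fun z => K z - S n z) 2 μ) atTop (𝓝 0)) :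
    Tendsto (fun n => ∫ z, S n z * φ z ∂μ) atTop (𝓝 (∫ z, K z * φ z ∂μ)) := by
  have h1 : Tendsto (fun n => (hS n).toLp (S n)) atTop (𝓝 (hK.toLp K)) := by
    rw [Lp.tendsto_Lp_iff_tendsto_eLpNorm'']
    refine h.congr fun n => ?_
    rw [← eLpNorm_neg]
    congr 1
    ext z
    simp
  have h2 := h1.inner (tendsto_const_nhds (x := hφ.toLp φ) (f := atTop)) (𝕜 := ℝ)
  simpa only [MemLp.inner_toLp] using h2

section Coupling

variable {F π : Measure (ℝ × ℝ)} {a b : ℝ × ℝ → ℝ} {μ ν : Measure ℝ} {K : ℝ × ℝ → ℝ}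
  {α β : ℕ → ℝ[X]} {c : ℕ → ℝ}

lemma IsCoupling.memLp_mul [SFinite ν] (hc : IsCoupling F π a b μ ν) {φ ψ : ℝ → ℝ}
    (hφm : Measurable φ) (hψm : Measurable ψ) (hφ : MemLp φ 2 μ) (hψ : MemLp ψ 2 ν) :
    MemLp (fun z => φ (a z) * ψ (b z)) 2 π := by
  have : MemLp (fun z : ℝ × ℝ => φ z.1 * ψ z.2) 2 (μ.prod ν) := by
    rw [memLp_two_iff_integrable_sq (by fun_prop)]
    exact (hφ.integrable_sq.mul_prod hψ.integrable_sq).congr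
      (ae_of_all _ fun z => by simp [mul_pow])
  exact this.comp_measurePreserving hc.prod

lemma IsCoupling.integral_mul [SFinite μ] [SFinite ν] (hc : IsCoupling F π a b μ ν)
    {φ ψ : ℝ → ℝ} (hφ : Measurable φ) (hψ : Measurable ψ) :
    ∫ z, φ (a z) * ψ (b z) ∂π = (∫ x, φ x ∂μ) * ∫ y, ψ y ∂ν := by
  rw [hc.prod.integral_comp_of_measurable (φ := fun z => φ z.1 * ψ z.2) (by fun_prop),
    integral_prod_mul]

/-- The mixed integrals of a distribution with a Lancaster expansion. -/
theorem IsCoupling.integral_eval_mul_of_expansion [SFinite μ] [SFinite ν]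
    (hc : IsCoupling F π a b μ ν)
    (hμ : HasFiniteMoments μ) (hν : HasFiniteMoments ν) (hK : MemLp K 2 π)
    (hF : ∀ φ : ℝ × ℝ → ℝ, ∫ z, K z * φ z ∂π = ∫ z, φ z ∂F)
    (hα : IsOrthogonalPolySeq μ α)
    (hS : Tendsto (fun N : ℕ => eLpNorm (fun z : ℝ × ℝ => K z -
      ∑ n ∈ Finset.range N, c n * ((α n).eval (a z) * (β n).eval (b z))) 2 π) atTop (𝓝 0))
    (n : ℕ) {ψ : ℝ → ℝ} (hψm : Measurable ψ) (hψ : MemLp ψ 2 ν) :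
    ∫ z, (α n).eval (a z) * ψ (b z) ∂F =
      c n * (∫ x, (α n).eval x * (α n).eval x ∂μ) * ∫ y, (β n).eval y * ψ y ∂ν := by
  have hm : ∀ k, Measurable fun x => (α k).eval x := fun k => (α k).continuous.measurable
  have hm' : ∀ k, Measurable fun x => (β k).eval x := fun k => (β k).continuous.measurable
  have hSm : ∀ k, MemLp (fun z => (α k).eval (a z) * (β k).eval (b z)) 2 π := fun k =>
    hc.memLp_mul (hm k) (hm' k) (hμ.memLp_eval _) (hν.memLp_eval _)
  have hφ : MemLp (fun z => (α n).eval (a z) * ψ (b z)) 2 π :=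
    hc.memLp_mul (hm n) hψm (hμ.memLp_eval _) hψ
  have ht := tendsto_integral_mul_of_tendsto_eLpNorm hK
    (fun N => memLp_finsetSum (Finset.range N) fun k _ => (hSm k).const_mul (c k)) hφ hS
  rw [hF] at ht
  refine tendsto_nhds_unique ht (tendsto_const_nhds.congr' ?_)
  -- Once `N > n`, orthogonality of the `α k` leaves only the term `k = n`, so the pairings no
  -- longer depend on `N`.
  filter_upwards [eventually_gt_atTop n] with N hN
  have hterm : ∀ k, ∫ z, c k * ((α k).eval (a z) * (β k).eval (b z)) *
      ((α n).eval (a z) * ψ (b z)) ∂π =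
      c k * (∫ x, (α k).eval x * (α n).eval x ∂μ) * ∫ y, (β k).eval y * ψ y ∂ν := fun k => by
    have := hc.integral_mul (φ := fun x => (α k).eval x * (α n).eval x)
      (ψ := fun y => (β k).eval y * ψ y) ((hm k).mul (hm n)) ((hm' k).mul hψm)
    rw [mul_assoc (c k) (∫ x, _ ∂μ), ← this, ← integral_const_mul]
    congr with z
    ring
  simp_rw [Finset.sum_mul]
  rw [integral_finsetSum]
  · simp_rw [hterm]
    rw [Finset.sum_eq_single n]
    · intro k _ hk
      rw [hα.2 k n hk, mul_zero, zero_mul]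
    · intro h
      exact absurd (Finset.mem_range.2 hN) h
  · intro k _
    exact ((hSm k).const_mul (c k)).integrable_mul hφ

/-- A distribution with a Lancaster expansion has polynomial conditional moments. -/
theorem IsCoupling.exists_condMomentEq_of_expansion [IsProbabilityMeasure F]
    (hc : IsCoupling F π a b μ ν)
    (hμ : HasFiniteMoments μ) (hν : HasFiniteMoments ν) (hK : MemLp K 2 π)
    (hF : ∀ φ : ℝ × ℝ → ℝ, ∫ z, K z * φ z ∂π = ∫ z, φ z ∂F)
    (hα : IsOrthogonalPolySeq μ α) (hβ : IsOrthogonalPolySeq ν β)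
    (hS : Tendsto (fun N : ℕ => eLpNorm (fun z : ℝ × ℝ => K z -
      ∑ n ∈ Finset.range N, c n * ((α n).eval (a z) * (β n).eval (b z))) 2 π) atTop (𝓝 0))
    (n : ℕ) : ∃ p : ℝ[X], p.degree ≤ n ∧
      (p.coeff n = 0 → c n = 0 ∨ ∫ x, (α n).eval x * (α n).eval x ∂μ = 0) ∧
      CondMomentEq F a b n p := by
  have : IsProbabilityMeasure μ := hc.left.map_eq ▸ Measure.isProbabilityMeasure_map
    hc.left.aemeasurable
  have : IsProbabilityMeasure ν := hc.right.map_eq ▸ Measure.isProbabilityMeasure_map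
    hc.right.aemeasurable
  obtain ⟨d, hd, hdn⟩ := exists_eq_sum_of_degree_eq hα.1 n (X ^ n) (degree_X_pow n).le
  set s : ℕ → ℝ := fun k => ∫ x, (α k).eval x * (α k).eval x ∂μ
  -- Here `X ^ n = ∑ d k * α k`, and `α k` has conditional expectation `c k * s k * β k`.
  refine ⟨∑ k ∈ Finset.range (n + 1), C (d k * (c k * s k)) * β k, ?_, ?_, ?_⟩
  · rw [← mem_degreeLE]
    refine Submodule.sum_mem _ fun k hk => mem_degreeLE.2 ?_
    refine (degree_C_mul_le_degree _ _).trans ?_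
    rw [hβ.1]
    simp only [Finset.mem_range] at hk
    exact_mod_cast Nat.lt_succ_iff.1 hk
  · intro h
    rw [finsetSum_coeff, Finset.sum_range_succ, Finset.sum_eq_zero, zero_add, coeff_C_mul] at h
    · have h1 : (β n).coeff n ≠ 0 := by
        have := coeff_ne_zero_of_eq_degree (hβ.1 n)
        exact this
      have h2 : d n ≠ 0 := by
        intro h0
        simp [h0] at hdn
      simpa [h1, h2] using h
    · intro k hk
      rw [coeff_C_mul, coeff_eq_zero_of_degree_lt, mul_zero]
      rw [hβ.1]
      simp only [Finset.mem_range] at hk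
      exact_mod_cast hk
  · have hxn : ∀ x : ℝ, x ^ n = ∑ k ∈ Finset.range (n + 1), d k * (α k).eval x := fun x => by
      have := congrArg (eval x) hd
      simpa [eval_finsetSum] using this
    have hia : ∀ P : ℝ[X], Integrable (fun z => P.eval (a z)) F := fun P =>
      hc.left.integrable_comp_of_integrable (hμ.integrable_eval P)
    have hib : ∀ P : ℝ[X], Integrable (fun z => P.eval (b z)) F := fun P =>
      hc.right.integrable_comp_of_integrable (hν.integrable_eval P)
    refine EventuallyEq.symm ?_
    refine ae_eq_condExp_of_forall_setIntegral_eq hc.right.measurable.comap_le ?_ ?_ ?_ ?_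
    · simpa using hia (X ^ n)
    · intro t _ _
      exact (hib _).integrableOn
    -- The sets of the conditioning σ-algebra are the preimages of Borel sets `B`, so the mixed
    -- integral formula is used with the indicator of `B` as `ψ`.
    · rintro _ ⟨B, hB, rfl⟩ -
      have hset : ∀ φ : ℝ × ℝ → ℝ, ∫ z in b ⁻¹' B, φ z ∂F =
          ∫ z, φ z * B.indicator 1 (b z) ∂F := fun φ => by
        rw [← integral_indicator (hc.right.measurable hB)]
        congr with z
        by_cases hz : b z ∈ B
        · rw [Set.indicator_of_mem (by exact hz), Set.indicator_of_mem hz]; simp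
        · rw [Set.indicator_of_notMem (by exact hz), Set.indicator_of_notMem hz]; simp
      have hψm : Measurable (B.indicator 1 : ℝ → ℝ) := measurable_one.indicator hB
      have hψ : MemLp (B.indicator 1 : ℝ → ℝ) 2 ν := (memLp_const 1).indicator hB
      simp_rw [hxn, eval_finsetSum]
      rw [integral_finsetSum, integral_finsetSum]
      · refine Finset.sum_congr rfl fun k _ => ?_
        simp only [eval_mul, eval_C]
        rw [integral_const_mul, integral_const_mul, hset, hset,
          hc.integral_eval_mul_of_expansion hμ hν hK hF hα hS k hψm hψ,
          hc.right.integral_comp_of_measurable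
            (φ := fun y => (β k).eval y * B.indicator 1 y) ((β k).continuous.measurable.mul hψm)]
        ring
      · intro k _
        exact ((hia (α k)).const_mul _).integrableOn
      · intro k _
        exact (hib _).integrableOn
    · have h1 : Measurable[MeasurableSpace.comap b inferInstance] b := comap_measurable b
      exact (Continuous.measurable (Polynomial.continuous _)).comp h1 |>.stronglyMeasurable
        |>.aestronglyMeasurable

/-- Mixed moments in terms of the conditional moments. -/
theorem IsCoupling.exists_integral_mul_eq_of_condMomentEq [IsProbabilityMeasure F]
    (hc : IsCoupling F π a b μ ν) (hμ : HasFiniteMoments μ) (hν : HasFiniteMoments ν)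
    {p : ℕ → ℝ[X]} (hp : ∀ n, (p n).degree ≤ n) (h : ∀ n, CondMomentEq F a b n (p n))
    (n : ℕ) {P : ℝ[X]} (hP : P.degree ≤ n) :
    ∃ R : ℝ[X], R.degree ≤ n ∧ R.coeff n = P.coeff n * (p n).coeff n ∧
      ∀ Q : ℝ[X], ∫ z, P.eval (a z) * Q.eval (b z) ∂F = ∫ y, R.eval y * Q.eval y ∂ν := by
  have hma : ∀ P : ℝ[X], MemLp (fun z => P.eval (a z)) 2 F := fun P =>
    (hμ.memLp_eval P).comp_measurePreserving hc.left
  have hmb : ∀ P : ℝ[X], MemLp (fun z => P.eval (b z)) 2 F := fun P =>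
    (hν.memLp_eval P).comp_measurePreserving hc.right
  have hpull : ∀ (k : ℕ) (Q : ℝ[X]),
      ∫ z, a z ^ k * Q.eval (b z) ∂F = ∫ y, (p k).eval y * Q.eval y ∂ν := fun k Q => by
    have hk : MemLp (fun z => a z ^ k) 2 F := by
      have := hma (X ^ k)
      simpa only [eval_pow, eval_X] using this
    have h1 : Measurable[MeasurableSpace.comap b inferInstance] b := comap_measurable b
    have h2 : StronglyMeasurable[MeasurableSpace.comap b inferInstance] fun z => Q.eval (b z) :=
      (Q.continuous.measurable.comp h1).stronglyMeasurable
    have h3 := condExp_mul_of_stronglyMeasurable_right h2 (hk.integrable_mul (hmb Q))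
      (hk.integrable one_le_two)
    have h4 := integral_condExp hc.right.measurable.comap_le (μ := F)
      (f := (fun z => a z ^ k) * fun z => Q.eval (b z))
    simp only [Pi.mul_apply] at h4
    rw [← h4, ← hc.right.integral_comp_of_measurable (φ := fun y => (p k).eval y * Q.eval y)
      (by fun_prop)]
    refine integral_congr_ae ?_
    filter_upwards [h3, h k] with z hz1 hz2
    rw [hz1, Pi.mul_apply, hz2]
  have hnd : P.natDegree ≤ n := natDegree_le_iff_degree_le.2 hP
  -- This polynomial in `b` is the conditional expectation of `P(a)`; only `k = n` contributes to
  -- its coefficient of order `n`.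
  refine ⟨∑ k ∈ Finset.range (n + 1), C (P.coeff k) * p k, ?_, ?_, fun Q => ?_⟩
  · rw [← mem_degreeLE]
    refine Submodule.sum_mem _ fun k hk => mem_degreeLE.2 ?_
    refine (degree_C_mul_le_degree _ _).trans ((hp k).trans ?_)
    simp only [Finset.mem_range] at hk
    exact_mod_cast Nat.lt_succ_iff.1 hk
  · rw [finsetSum_coeff, Finset.sum_range_succ, Finset.sum_eq_zero, zero_add, coeff_C_mul]
    intro k hk
    rw [coeff_C_mul, coeff_eq_zero_of_degree_lt (p := p k), mul_zero]
    refine (hp k).trans_lt ?_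
    simp only [Finset.mem_range] at hk
    exact_mod_cast hk
  · have hPe : ∀ x, P.eval x = ∑ k ∈ Finset.range (n + 1), P.coeff k * x ^ k := fun x =>
      eval_eq_sum_range' (Nat.lt_succ_iff.2 hnd) x
    simp_rw [hPe, eval_finsetSum, Finset.sum_mul]
    rw [integral_finsetSum, integral_finsetSum]
    · refine Finset.sum_congr rfl fun k _ => ?_
      simp only [eval_mul, eval_C, mul_assoc]
      rw [integral_const_mul, integral_const_mul, hpull]
    · intro k _
      exact hν.integrable_eval_mul _ _
    · intro k _
      have := (hma (C (P.coeff k) * X ^ k)).integrable_mul (hmb Q)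
      exact this.congr (ae_of_all _ fun z => by simp)

end Coupling

section Coupling

variable {F π : Measure (ℝ × ℝ)} {a b : ℝ × ℝ → ℝ} {μ ν : Measure ℝ} {K : ℝ × ℝ → ℝ}
  {α β : ℕ → ℝ[X]} {c : ℕ → ℝ}

/-- A polynomial conditional moment has full order, after a modification on a null set, unless
the leading coefficient is forced to vanish. -/
lemma IsCoupling.exists_degree_eq_of_condMomentEq
    (hc : IsCoupling F π a b μ ν) (hμ : HasFiniteMoments μ)
    (hα : IsOrthogonalPolySeq μ α) (hsupp : μ.support.encard = ν.support.encard) {n : ℕ}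
    (hcn : c n ≠ 0) {p : ℝ[X]} (hpd : p.degree ≤ n)
    (hpc : p.coeff n = 0 → c n = 0 ∨ ∫ x, (α n).eval x * (α n).eval x ∂μ = 0)
    (hp : CondMomentEq F a b n p) : ∃ q : ℝ[X], q.degree = n ∧ CondMomentEq F a b n q := by
  by_cases h0 : p.coeff n = 0
  · have hαn := hμ.ae_eval_eq_zero_of_integral_eq_zero ((hpc h0).resolve_left hcn)
    have hle := (support_encard_le_iff n).2 ⟨α n, hα.1 n, hαn⟩
    rw [hsupp] at hle
    obtain ⟨r, hr, hr0⟩ := (support_encard_le_iff n).1 hle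
    -- Here `α n` vanishes almost everywhere, so both supports have at most `n` points; the null
    -- polynomial `r` supplies the missing top degree.
    refine ⟨p + r, ?_, ?_⟩
    · rw [degree_add_eq_right_of_degree_lt, hr]
      rw [hr]
      refine lt_of_le_of_ne hpd fun h => ?_
      exact coeff_ne_zero_of_eq_degree h h0
    · filter_upwards [hp, hc.right.quasiMeasurePreserving.ae hr0] with z h1 h2
      rw [h1, eval_add, h2, add_zero]
  · exact ⟨p, le_antisymm hpd (le_degree_of_ne_zero h0), hp⟩

/-- Orthogonality of the mixed moments, from polynomial conditional moments. -/
lemma IsCoupling.integral_eval_mul_eval_eq_zero [IsProbabilityMeasure F]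
    (hc : IsCoupling F π a b μ ν) (hμ : HasFiniteMoments μ) (hν : HasFiniteMoments ν)
    {p : ℕ → ℝ[X]} (hp : ∀ n, (p n).degree ≤ n) (h : ∀ n, CondMomentEq F a b n (p n))
    (hα : IsOrthogonalPolySeq μ α) (hβ : IsOrthogonalPolySeq ν β) {m n : ℕ} (hmn : m < n) :
    ∫ z, (α m).eval (a z) * (β n).eval (b z) ∂F = 0 := by
  obtain ⟨R, hR, -, hRQ⟩ :=
    hc.exists_integral_mul_eq_of_condMomentEq hμ hν hp h m (hα.1 m).le
  rw [hRQ, hβ.integral_mul_eq_zero hν (hR.trans_lt (by exact_mod_cast hmn))]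

/-- If the conditional moments have full order, then a vanishing coefficient of the expansion
belongs to a term that vanishes almost everywhere. -/
lemma IsCoupling.ae_eval_eq_zero_of_coeff_eq_zero [IsProbabilityMeasure F] [SFinite μ] [SFinite ν]
    (hc : IsCoupling F π a b μ ν) (hμ : HasFiniteMoments μ) (hν : HasFiniteMoments ν)
    (hK : MemLp K 2 π) (hF : ∀ φ : ℝ × ℝ → ℝ, ∫ z, K z * φ z ∂π = ∫ z, φ z ∂F)
    (hα : IsOrthogonalPolySeq μ α) (hβ : IsOrthogonalPolySeq ν β)
    (hS : Tendsto (fun N : ℕ => eLpNorm (fun z : ℝ × ℝ => K z -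
      ∑ n ∈ Finset.range N, c n * ((α n).eval (a z) * (β n).eval (b z))) 2 π) atTop (𝓝 0))
    {p : ℕ → ℝ[X]} (hp : ∀ n, (p n).degree = n) (h : ∀ n, CondMomentEq F a b n (p n))
    {n : ℕ} (hcn : c n = 0) : ∀ᵐ y ∂ν, (β n).eval y = 0 := by
  obtain ⟨R, hR, hRn, hRQ⟩ :=
    hc.exists_integral_mul_eq_of_condMomentEq hμ hν (fun n => (hp n).le) h n (hα.1 n).le
  -- Testing with `ψ = R`, the conditional expectation of `α n (a)`, gives `∫ R² dν = 0` when `c n =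
  -- 0`, while `R` has degree exactly `n`.
  have h1 := hc.integral_eval_mul_of_expansion hμ hν hK hF hα hS n R.continuous.measurable
    (hν.memLp_eval R)
  rw [hcn, zero_mul, zero_mul, hRQ] at h1
  refine hβ.ae_eval_eq_zero hν (le_antisymm hR (le_degree_of_ne_zero ?_))
    (hν.ae_eval_eq_zero_of_integral_eq_zero h1)
  rw [hRn]
  exact mul_ne_zero (coeff_ne_zero_of_eq_degree (hα.1 n)) (coeff_ne_zero_of_eq_degree (hp n))

end Coupling

/-! ### Comparison of the Lancaster and polynomial classes -/

section Lancaster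

variable {F : Measure (ℝ × ℝ)} {α β : ℕ → ℝ[X]} {c : ℕ → ℝ}

lemma integral_productDensity_mul [IsProbabilityMeasure F] (hac : F ≪ F.fst.prod F.snd)
    (φ : ℝ × ℝ → ℝ) :
    ∫ z, productDensity F z * φ z ∂(F.fst.prod F.snd) = ∫ z, φ z ∂F :=
  integral_toReal_rnDeriv_mul hac

lemma HasLancasterExpansion.tendsto_fst_snd (h : HasLancasterExpansion F α β c) :
    Tendsto (fun N : ℕ => eLpNorm (fun z : ℝ × ℝ => productDensity F z -
      ∑ n ∈ Finset.range N, c n * ((α n).eval z.1 * (β n).eval z.2)) 2 (F.fst.prod F.snd))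
      atTop (𝓝 0) := by
  simpa only [mul_assoc] using h.2

lemma HasLancasterExpansion.tendsto_snd_fst (h : HasLancasterExpansion F α β c) :
    Tendsto (fun N : ℕ => eLpNorm (fun z : ℝ × ℝ => productDensity F z -
      ∑ n ∈ Finset.range N, c n * ((β n).eval z.2 * (α n).eval z.1)) 2 (F.fst.prod F.snd))
      atTop (𝓝 0) := by
  have : ∀ (z : ℝ × ℝ) n, c n * ((β n).eval z.2 * (α n).eval z.1) =
      c n * (α n).eval z.1 * (β n).eval z.2 := fun z n => by ring
  simpa only [this] using h.2

theorem IsLancasterClass.isWeakPolynomialClass [IsProbabilityMeasure F] (h : IsLancasterClass F) :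
    IsWeakPolynomialClass F := by
  obtain ⟨h1, h2, ⟨hac, hK⟩, α, β, c, hα, hβ, hS⟩ := h
  refine ⟨h1, h2, fun n => ⟨?_, ?_⟩⟩
  · obtain ⟨p, hp, -, hpc⟩ := (isCoupling_fst_snd F).exists_condMomentEq_of_expansion h1.1 h2.1 hK
      (integral_productDensity_mul hac) hα hβ hS.tendsto_fst_snd n
    exact ⟨p, hp, hpc⟩
  · obtain ⟨p, hp, -, hpc⟩ := (isCoupling_snd_fst F).exists_condMomentEq_of_expansion h2.1 h1.1 hK
      (integral_productDensity_mul hac) hβ hα hS.tendsto_snd_fst n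
    exact ⟨p, hp, hpc⟩

theorem IsNondegenerateLancasterClass.isPolynomialClass [IsProbabilityMeasure F]
    (h : IsNondegenerateLancasterClass F)
    (hsupp : F.fst.support.encard = F.snd.support.encard) : IsPolynomialClass F := by
  obtain ⟨h1, h2, ⟨hac, hK⟩, α, β, c, hα, hβ, hc, hS⟩ := h
  refine ⟨h1, h2, fun n => ⟨?_, ?_⟩⟩
  · obtain ⟨p, hp, hpn, hpc⟩ := (isCoupling_fst_snd F).exists_condMomentEq_of_expansion h1.1 h2.1
      hK (integral_productDensity_mul hac) hα hβ hS.tendsto_fst_snd n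
    exact (isCoupling_fst_snd F).exists_degree_eq_of_condMomentEq h1.1 hα hsupp (hc n) hp hpn hpc
  · obtain ⟨p, hp, hpn, hpc⟩ := (isCoupling_snd_fst F).exists_condMomentEq_of_expansion h2.1 h1.1
      hK (integral_productDensity_mul hac) hβ hα hS.tendsto_snd_fst n
    exact (isCoupling_snd_fst F).exists_degree_eq_of_condMomentEq h2.1 hβ hsupp.symm (hc n) hp hpn
      hpc

/-- The coefficient of index `(m, n)` vanishes for `m < n` through `E(X ^ k | Y)` and for `m > n`
through `E(Y ^ k | X)`. Any choice of orthogonal polynomials is allowed. -/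
theorem IsWeakPolynomialClass.exists_hasLancasterExpansion [IsProbabilityMeasure F]
    (h : IsWeakPolynomialClass F)
    (hL2 : HasSquareIntegrableDensity F) (hα : IsOrthogonalPolySeq F.fst α)
    (hβ : IsOrthogonalPolySeq F.snd β) : ∃ c, HasLancasterExpansion F α β c := by
  obtain ⟨h1, h2, h3⟩ := h
  choose p hp hpc using fun n => (h3 n).1
  choose q hq hqc using fun n => (h3 n).2
  obtain ⟨c, hS⟩ := exists_tendsto_eLpNorm_diagonal_expansion h1 h2 hα hβ hL2.2 fun m n hmn => by
    rw [integral_productDensity_mul hL2.1]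
    rcases lt_or_gt_of_ne hmn with hlt | hlt
    · exact (isCoupling_fst_snd F).integral_eval_mul_eval_eq_zero h1.1 h2.1 hp hpc hα hβ hlt
    · simp_rw [mul_comm ((α m).eval _)]
      exact (isCoupling_snd_fst F).integral_eval_mul_eval_eq_zero h2.1 h1.1 hq hqc hβ hα hlt
  exact ⟨c, hL2.1, hS⟩

theorem IsWeakPolynomialClass.isLancasterClass [IsProbabilityMeasure F]
    (h : IsWeakPolynomialClass F)
    (hL2 : HasSquareIntegrableDensity F) : IsLancasterClass F := by
  have hα := HasFiniteMoments.isOrthogonalPolySeq_gramSchmidtPoly h.1.1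
  have hβ := HasFiniteMoments.isOrthogonalPolySeq_gramSchmidtPoly h.2.1.1
  obtain ⟨c, hS⟩ := h.exists_hasLancasterExpansion hL2 hα hβ
  exact ⟨h.1, h.2.1, hL2, _, _, c, hα, hβ, hS⟩

lemma IsPolynomialClass.isWeakPolynomialClass (h : IsPolynomialClass F) :
    IsWeakPolynomialClass F :=
  ⟨h.1, h.2.1, fun n => ⟨(h.2.2 n).1.imp fun _ hp => ⟨hp.1.le, hp.2⟩,
    (h.2.2 n).2.imp fun _ hq => ⟨hq.1.le, hq.2⟩⟩⟩

theorem IsPolynomialClass.isNondegenerateLancasterClass [IsProbabilityMeasure F]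
    (h : IsPolynomialClass F)
    (hL2 : HasSquareIntegrableDensity F) : IsNondegenerateLancasterClass F := by
  obtain ⟨h1, h2, -, α, β, c, hα, hβ, hS⟩ := h.isWeakPolynomialClass.isLancasterClass hL2
  choose p hp hpc using fun n => (h.2.2 n).1
  have hzero : ∀ n, c n = 0 → ∀ᵐ z ∂(F.fst.prod F.snd), (β n).eval z.2 = 0 := fun n hcn =>
    Measure.quasiMeasurePreserving_snd.ae
      ((isCoupling_fst_snd F).ae_eval_eq_zero_of_coeff_eq_zero h1.1 h2.1 hL2.2
        (integral_productDensity_mul hL2.1) hα hβ hS.tendsto_fst_snd hp hpc hcn)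
  -- Replacing a zero coefficient by `1` changes the partial sums only on a null set, as the
  -- corresponding `β n` vanishes almost everywhere.
  refine ⟨h1, h2, hL2, α, β, fun n => if c n = 0 then 1 else c n, hα, hβ, fun n => ?_, hS.1, ?_⟩
  · dsimp only
    split_ifs with hcn
    · exact one_ne_zero
    · exact hcn
  · refine hS.2.congr fun N => eLpNorm_congr_ae ?_
    have hall : ∀ᵐ z ∂(F.fst.prod F.snd), ∀ n, c n = 0 → (β n).eval z.2 = 0 :=
      ae_all_iff.2 fun n => by
        by_cases hcn : c n = 0
        · filter_upwards [hzero n hcn] with z hz _ using hz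
        · exact ae_of_all _ fun z h0 => absurd h0 hcn
    filter_upwards [hall] with z hz
    congr 1
    refine Finset.sum_congr rfl fun n _ => ?_
    by_cases hcn : c n = 0
    · rw [hz n hcn, mul_zero, mul_zero]
    · rw [if_neg hcn]

end Lancaster

/-- Since `encard` is `⊤` on every infinite set, a single equality covers both alternatives for the
supports. -/
theorem theorem3 (F : Measure (ℝ × ℝ)) [IsProbabilityMeasure F]
    (hL2 : HasSquareIntegrableDensity F)
    (hfst : IsMomentDeterminate F.fst) (hsnd : IsMomentDeterminate F.snd) :
    (IsLancasterClass F ↔ IsWeakPolynomialClass F) ∧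
      (F.fst.support.encard = F.snd.support.encard →
        (IsNondegenerateLancasterClass F ↔ IsPolynomialClass F)) := by
  exact ⟨⟨fun h => h.isWeakPolynomialClass, fun h => h.isLancasterClass hL2⟩, fun hsupp =>
    ⟨fun h => h.isPolynomialClass hsupp, fun h => h.isNondegenerateLancasterClass hL2⟩⟩
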